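/- **Setting.** Let $1\le k<n$ and $q\ge 1$, let $X\in\mathbb R^{n\times k}$ have rank $k$, let $R\in\mathbb R^{q\times k}$ have rank $q$, and let $r\in\mathbb R^q$. Put $\mathfrak M_0=\{X\beta:\beta\in\mathbb R^k,\ R\beta=r\}$, and let $\mathfrak M_0^{lin}$ be the linear space parallel to $\mathfrak M_0$. Let $G(\mathfrak M_0)$ be the group of all maps $y\mapsto\delta(y-\mu_0)+\mu_0'$ with $\delta\in\mathbb R\setminus\{0\}$ and $\mu_0,\mu_0'\in\mathfrak M_0$. Let $\mathfrak F_{\mathrm{all}}$ be the set of all normalized spectral densities, i.e. even integrable functions $f:[-\pi,\pi]\to[0,\infty)$ with $\int_{-\pi}^{\pi}f=1$. For $f\in\mathfrak F_{\mathrm{all}}$ let $\Sigma(f)=\big[\int_{-\pi}^{\pi}e^{-\iota(j-l)\omega}f(\omega)\,d\omega\big]_{j,l=1}^n$. Let $P_{\mu,A}$ be the Gaussian law on $\mathbb R^n$ with mean $\mu$ and covariance matrix $A$. For an affine subspace $\mathcal A$ of $\mathbb R^n$ let $\lambda_{\mathcal A}$ be Lebesgue measure on $\mathcal A$, viewed as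 a Borel measure on $\mathbb R^n$ (point mass if $\dim\mathcal A=0$). $\Pi_{\mathcal K}$ denotes orthogonal projection onto a linear subspace $\mathcal K$. For $\omega\in[0,\pi]$ and an integer $s\ge0$ let $E_{n,s}(\omega)$ be the $n\times2$ matrix with $j$-th row $(j^s\cos(j\omega),\,j^s\sin(j\omega))$, $1\le j\le n$. For a linear subspace $\mathcal L\subseteq\mathbb R^n$ with $\dim\mathcal L<n$ let $\rho(\omega,\mathcal L)=\min\{s\ge0:\operatorname{span}(E_{n,s}(\omega))\not\subseteq\mathcal L\}$ (which exists, and is positive for at most finitely many $\omega\in[0,\pi]$). Let $\kappa(\omega,d)=d$ for $\omega\in\{0,\pi\}$ and $\kappa(\omega,d)=2d$ for $\omega\in(0,\pi)$. Let $\Delta_\omega(z)=1-\cos(\omega)z$ for $\omega\in\{0,\pi\}$ and $\Delta_\omega(z)=1-2\cos(\omega)z+z^2$ for $\omega\in(0,\pi)$. Put $$\kappa_{\mathcal L}=\sum_{\omega\in[0,\pi],\,\rho(\omega,\mathcal L)>0}\kappa(\omega,\rho(\omega,\mathcal L)),\qquad \Delta_{\mathcal L}(z)=\prod_{\omega\in[0,\pi],\,\rho(\omega,\mathcal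 L)>0}\Delta_\omega(z)^{\rho(\omega,\mathcal L)}.$$ For $\emptyset\ne\mathfrak F\subseteq\mathfrak F_{\mathrm{all}}$ let $\mathbb M(\mathfrak F,\mathcal L)$ be the set of all finite Borel measures $\mathsf m$ on $[-\pi,\pi]$, symmetric about $0$ and with finite support, such that (i) for some sequence $f_j\in\mathfrak F$, $\mathsf m$ is the weak limit of the measures with Lebesgue densities $$g_j(\nu)=|\Delta_{\mathcal L}(e^{\iota\nu})|^2f_j(\nu)\Big/\int_{-\pi}^{\pi}|\Delta_{\mathcal L}(e^{\iota\nu'})|^2f_j(\nu')\,d\nu',$$ and (ii) $\sum_{\gamma\in\operatorname{supp}(\mathsf m)\cap[0,\pi]}\kappa(\gamma,1)<n-\kappa_{\mathcal L}$. Let $\mathbb S(\mathfrak F,\mathcal L)=\{\operatorname{supp}(\mathsf m)\cap[0,\pi]:\mathsf m\in\mathbb M(\mathfrak F,\mathcal L)\}$. For $\Gamma\subseteq[0,\pi]$ let $\mathcal S_\Gamma$ be the span of the columns of all matrices $\Pi_{\mathcal L^\perp}E_{n,\rho(\gamma,\mathcal L)}(\gamma)$, $\gamma\in\Gamma$. **Theorem.**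 Let $\emptyset\ne\mathfrak F\subseteq\mathfrak F_{\mathrm{all}}$. Let $T:\mathbb R^n\to\mathbb R$ be Borel-measurable and continuous on the complement of a closed set $N^\dagger\subseteq\mathbb R^n$. Assume that $T$ and $N^\dagger$ are $G(\mathfrak M_0)$-invariant and are invariant under addition of elements of a linear subspace $\mathcal V$ of $\mathbb R^n$. Let $\mathcal L=\operatorname{span}(\mathfrak M_0^{lin}\cup\mathcal V)$ and assume $\dim\mathcal L<n$. Let $\mathbb J$ be the set of all linear subspaces $\mathcal S$ of $\mathbb R^n$ with $\dim\mathcal S<n-\dim\mathcal L$ that are of the form $\mathcal S=\mathcal S_\Gamma$ with $\Gamma\in\mathbb S(\mathfrak F,\mathcal L)$. Consider the condition $$(\ast)\qquad\text{for every }\mathcal S\in\mathbb J:\quad \lambda_{\mu_0+\mathcal S}(N^\dagger)=0\ \text{ for some }\mu_0\in\mathfrak M_0 .$$ 1. If $(\ast)$ holds, then for every $0<\alpha<1$ there is a real number $C(\alpha)$ with $$\sup_{\mu_0\in\mathfrak M_0}\ \sup_{0<\sigma^2<\infty}\ \sup_{f\in\mathfrak F}P_{\mu_0,\sigma^2\Sigma(f)}(T\ge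 C(\alpha))\le\alpha .$$ For each $\mathcal S\in\mathbb J$, "for some $\mu_0\in\mathfrak M_0$" in $(\ast)$ is equivalent to "for all $\mu_0\in\mathfrak M_0$". If $N^\dagger$ is a finite or countable union of affine subspaces, then, for each $\mathcal S\in\mathbb J$, the requirement in $(\ast)$ is equivalent to $\mu_0+\mathcal S\not\subseteq N^\dagger$ for some $\mu_0\in\mathfrak M_0$, and also to $\mu_0+\mathcal S\not\subseteq N^\dagger$ for all $\mu_0\in\mathfrak M_0$. 2. Suppose $N^\dagger$ is a finite or countable union of affine subspaces. If for every $\gamma\in\bigcup\mathbb S(\mathfrak F,\mathcal L)$ one has $\mu_0+\operatorname{span}(\Pi_{\mathcal L^\perp}E_{n,\rho(\gamma,\mathcal L)}(\gamma))\not\subseteq N^\dagger$ for some $\mu_0\in\mathfrak M_0$ (equivalently, for all $\mu_0\in\mathfrak M_0$), then $(\ast)$ holds. Requiring the same for every $\gamma\in[0,\pi]$ is a stricter sufficient condition: it implies the preceding condition, and hence $(\ast)$. -/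

import Mathlib

open MeasureTheory ProbabilityTheory Set Filter Topology

noncomputable section

namespace SizeControl

/-! ### The regression model and the null hypothesis -/

/-- The affine space `{X β : R β = r}` of null means, as an affine subspace of `ℝⁿ`. -/
def nullSpace {n k q : ℕ} (X : Matrix (Fin n) (Fin k) ℝ) (R : Matrix (Fin q) (Fin k) ℝ)
    (r : Fin q → ℝ) : AffineSubspace ℝ (EuclideanSpace ℝ (Fin n)) where
  carrier := {μ | ∃ β : Fin k → ℝ, μ = WithLp.toLp 2 (X.mulVec β) ∧ R.mulVec β = r}
  smul_vsub_vadd_mem' := by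
    rintro c _ _ _ ⟨β₁, rfl, h₁⟩ ⟨β₂, rfl, h₂⟩ ⟨β₃, rfl, h₃⟩
    refine ⟨c • (β₁ - β₂) + β₃, ?_, ?_⟩
    · simp [Matrix.mulVec_add, Matrix.mulVec_smul, Matrix.mulVec_sub]
    · simp [Matrix.mulVec_add, Matrix.mulVec_smul, Matrix.mulVec_sub, h₁, h₂, h₃]

/-- The set `G(M)` of all maps `y ↦ δ (y - μ) + μ'` with `δ ≠ 0` and `μ, μ' ∈ M`. -/
def affineGroup {n : ℕ} (M : AffineSubspace ℝ (EuclideanSpace ℝ (Fin n))) :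
    Set (EuclideanSpace ℝ (Fin n) → EuclideanSpace ℝ (Fin n)) :=
  {g | ∃ δ : ℝ, δ ≠ 0 ∧ ∃ μ ∈ M, ∃ μ' ∈ M, g = fun y => δ • (y - μ) + μ'}

/-- A function on `ℝⁿ` is invariant under all maps in `𝒢`. -/
def FunInvariant {n : ℕ} (𝒢 : Set (EuclideanSpace ℝ (Fin n) → EuclideanSpace ℝ (Fin n)))
    (T : EuclideanSpace ℝ (Fin n) → ℝ) : Prop :=
  ∀ g ∈ 𝒢, ∀ y, T (g y) = T y

/-- A subset of `ℝⁿ` is invariant under all maps in `𝒢`. -/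
def SetInvariant {n : ℕ} (𝒢 : Set (EuclideanSpace ℝ (Fin n) → EuclideanSpace ℝ (Fin n)))
    (N : Set (EuclideanSpace ℝ (Fin n))) : Prop :=
  ∀ g ∈ 𝒢, g '' N = N

/-- The translations by elements of a linear subspace `V`. -/
def translations {n : ℕ} (V : Submodule ℝ (EuclideanSpace ℝ (Fin n))) :
    Set (EuclideanSpace ℝ (Fin n) → EuclideanSpace ℝ (Fin n)) :=
  {g | ∃ v ∈ V, g = fun y => y + v}

/-- Lebesgue measure on the affine subspace `μ + S`, viewed as a Borel measure on `ℝⁿ`: the image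
of Lebesgue measure on `S` (normalized by an orthonormal basis of `S`) under `s ↦ μ + s`. For
`S = {0}` it is the point mass at `μ`. -/
def affineLebesgue {n : ℕ} (μ : EuclideanSpace ℝ (Fin n))
    (S : Submodule ℝ (EuclideanSpace ℝ (Fin n))) : Measure (EuclideanSpace ℝ (Fin n)) :=
  ((stdOrthonormalBasis ℝ S).toBasis.addHaar).map
    (fun s : S => μ + (s : EuclideanSpace ℝ (Fin n)))

/-- A set is a finite or countable union of affine subspaces. -/
def IsCountableUnionOfAffine {n : ℕ} (N : Set (EuclideanSpace ℝ (Fin n))) : Prop :=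
  ∃ 𝒜 : Set (AffineSubspace ℝ (EuclideanSpace ℝ (Fin n))), 𝒜.Countable ∧
    N = ⋃ A ∈ 𝒜, (A : Set (EuclideanSpace ℝ (Fin n)))

/-! ### Spectral densities -/

/-- Normalized spectral densities: nonnegative, even, integrable functions on `[-π, π]` with
integral one. The values of `f` outside `[-π, π]` play no role. -/
def normalizedSpectralDensities : Set (ℝ → ℝ) :=
  {f | (∀ ω ∈ Icc (-Real.pi) Real.pi, 0 ≤ f ω) ∧
    (∀ ω ∈ Icc (-Real.pi) Real.pi, f (-ω) = f ω) ∧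
    IntegrableOn f (Icc (-Real.pi) Real.pi) ∧ ∫ ω in (-Real.pi)..Real.pi, f ω = 1}

/-- The matrix `Σ(f)` with entries `∫ exp (-ι (j - l) ω) f ω dω` over `[-π, π]`; the integral is
real as `f` is even. -/
def spectralMatrix (n : ℕ) (f : ℝ → ℝ) : Matrix (Fin n) (Fin n) ℝ :=
  Matrix.of fun j l =>
    (∫ ω in (-Real.pi)..Real.pi,
      Complex.exp (-(Complex.I * (((j : ℕ) : ℂ) - ((l : ℕ) : ℂ)) * (ω : ℂ))) * (f ω : ℂ)).re

/-- The size `sup_{μ₀ ∈ M} sup_{0 < σ² < ∞} sup_{f ∈ 𝔉} P_{μ₀, σ² Σ(f)} (W)` of a rejection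
region `W`. -/
def size {n : ℕ} (M : AffineSubspace ℝ (EuclideanSpace ℝ (Fin n))) (𝔉 : Set (ℝ → ℝ))
    (W : Set (EuclideanSpace ℝ (Fin n))) : ENNReal :=
  ⨆ μ₀ ∈ M, ⨆ σ ∈ Ioi (0 : ℝ), ⨆ f ∈ 𝔉,
    multivariateGaussian μ₀ (σ ^ 2 • spectralMatrix n f) W

/-! ### Frequencies, their multiplicities, and the differencing polynomial -/

/-- The `n × 2` matrix whose `j`-th row, `1 ≤ j ≤ n`, is `(j ^ s cos (j ω), j ^ s sin (j ω))`. -/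
def trigMatrix (n s : ℕ) (ω : ℝ) : Matrix (Fin n) (Fin 2) ℝ :=
  Matrix.of fun i c =>
    ((i : ℕ) + 1 : ℝ) ^ s *
      (if c = 0 then Real.cos (((i : ℕ) + 1 : ℝ) * ω) else Real.sin (((i : ℕ) + 1 : ℝ) * ω))

/-- The span of the columns of a matrix, as a subspace of Euclidean space. -/
def colSpan {n m : ℕ} (A : Matrix (Fin n) (Fin m) ℝ) : Submodule ℝ (EuclideanSpace ℝ (Fin n)) :=
  Submodule.span ℝ (range fun c : Fin m => WithLp.toLp 2 (fun i => A i c))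

/-- `ρ(ω, L)`, the least `s` such that the span of `trigMatrix n s ω` is not contained in `L`. -/
def rho {n : ℕ} (ω : ℝ) (L : Submodule ℝ (EuclideanSpace ℝ (Fin n))) : ℕ :=
  sInf {s : ℕ | ¬ colSpan (trigMatrix n s ω) ≤ L}

open Classical in
/-- `κ(ω, d)`, equal to `d` for `ω ∈ {0, π}` and to `2 d` for `ω ∈ (0, π)`. -/
def kappa (ω : ℝ) (d : ℕ) : ℕ := if ω = 0 ∨ ω = Real.pi then d else 2 * d

open Classical in
/-- `Δ_ω(z)`, equal to `1 - cos(ω) z` for `ω ∈ {0, π}` and to `1 - 2 cos(ω) z + z²` for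
`ω ∈ (0, π)`. -/
def diffFactor (ω : ℝ) : Polynomial ℝ :=
  if ω = 0 ∨ ω = Real.pi then 1 - Polynomial.C (Real.cos ω) * Polynomial.X
  else 1 - Polynomial.C (2 * Real.cos ω) * Polynomial.X + Polynomial.X ^ 2

/-- The frequencies `ω ∈ [0, π]` with `ρ(ω, L) > 0`, a finite set if `dim L < n`. -/
def freqSet {n : ℕ} (L : Submodule ℝ (EuclideanSpace ℝ (Fin n))) : Set ℝ :=
  {ω | ω ∈ Icc 0 Real.pi ∧ 0 < rho ω L}

/-- `κ(ω(L), d(L))`, the sum of `κ(ω, ρ(ω, L))` over the frequencies in `freqSet L`. -/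
def kappaSum {n : ℕ} (L : Submodule ℝ (EuclideanSpace ℝ (Fin n))) : ℕ :=
  ∑ᶠ ω ∈ freqSet L, kappa ω (rho ω L)

/-- `Δ_{ω(L), d(L)}`, the product of `Δ_ω ^ ρ(ω, L)` over the frequencies in `freqSet L`. -/
def diffPoly {n : ℕ} (L : Submodule ℝ (EuclideanSpace ℝ (Fin n))) : Polynomial ℝ :=
  ∏ᶠ ω ∈ freqSet L, diffFactor ω ^ rho ω L

/-- `|Δ_{ω(L), d(L)} (exp (ι ν))|²`. -/
def diffGain {n : ℕ} (L : Submodule ℝ (EuclideanSpace ℝ (Fin n))) (ν : ℝ) : ℝ :=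
  ‖Polynomial.aeval (Complex.exp (Complex.I * (ν : ℂ))) (diffPoly L)‖ ^ 2

/-- The density `|Δ_{ω(L), d(L)} (exp (ι ν))|² f(ν)`, normalized to integrate to one. -/
def filteredDensity {n : ℕ} (L : Submodule ℝ (EuclideanSpace ℝ (Fin n))) (f : ℝ → ℝ) (ν : ℝ) : ℝ :=
  diffGain L ν * f ν / ∫ ν' in (-Real.pi)..Real.pi, diffGain L ν' * f ν'

/-- The Borel measure `m_g` on `[-π, π]` with Lebesgue density `g`, viewed as a measure on `ℝ`. -/
def densityMeasure (g : ℝ → ℝ) : Measure ℝ :=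
  (volume.restrict (Icc (-Real.pi) Real.pi)).withDensity fun ν => ENNReal.ofReal (g ν)

/-- The set `𝕄(𝔉, L)`: finite symmetric Borel measures `m` on `[-π, π]` (that is, on `ℝ` and
concentrated on `[-π, π]`) with finite support which (i) are weak limits of measures `m_{g_j}`, with
`g_j` the filtered density of some `f_j ∈ 𝔉`, and (ii) satisfy
`∑ κ(γ, 1) < n - κ(ω(L), d(L))`, the sum being over `γ` in the support of `m`, `0 ≤ γ ≤ π`. -/
def limitMeasures {n : ℕ} (𝔉 : Set (ℝ → ℝ)) (L : Submodule ℝ (EuclideanSpace ℝ (Fin n))) :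
    Set (FiniteMeasure ℝ) :=
  {m | (m : Measure ℝ) (Icc (-Real.pi) Real.pi)ᶜ = 0 ∧
    (m : Measure ℝ).map (fun ν => -ν) = (m : Measure ℝ) ∧
    (m : Measure ℝ).support.Finite ∧
    (∃ f : ℕ → ℝ → ℝ, (∀ j, f j ∈ 𝔉) ∧
      ∃ mg : ℕ → FiniteMeasure ℝ,
        (∀ j, (mg j : Measure ℝ) = densityMeasure (filteredDensity L (f j))) ∧
        Tendsto mg atTop (𝓝 m)) ∧
    (∑ᶠ γ ∈ (m : Measure ℝ).support ∩ Icc 0 Real.pi, kappa γ 1) + kappaSum L < n}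

/-- The set `𝕊(𝔉, L)` of all sets `supp m ∩ [0, π]` with `m ∈ 𝕄(𝔉, L)`. -/
def limitSupports {n : ℕ} (𝔉 : Set (ℝ → ℝ)) (L : Submodule ℝ (EuclideanSpace ℝ (Fin n))) :
    Set (Set ℝ) :=
  {Γ | ∃ m ∈ limitMeasures 𝔉 L, Γ = (m : Measure ℝ).support ∩ Icc 0 Real.pi}

/-- The span of the columns of the matrices `Π_{L^⊥} E_{n, ρ(γ, L)}(γ)`, `γ ∈ Γ`. -/
def projSpan {n : ℕ} (L : Submodule ℝ (EuclideanSpace ℝ (Fin n))) (Γ : Set ℝ) :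
    Submodule ℝ (EuclideanSpace ℝ (Fin n)) :=
  Submodule.span ℝ {v | ∃ γ ∈ Γ, ∃ c : Fin 2,
    v = Lᗮ.starProjection (WithLp.toLp 2 fun i => trigMatrix n (rho γ L) γ i c)}

/-- The linear subspaces `S` of dimension less than `n - dim L` of the form `projSpan L Γ` for some
`Γ ∈ 𝕊(𝔉, L)`. -/
def relevantSubspaces {n : ℕ} (𝔉 : Set (ℝ → ℝ)) (L : Submodule ℝ (EuclideanSpace ℝ (Fin n))) :
    Set (Submodule ℝ (EuclideanSpace ℝ (Fin n))) :=
  {S | Module.finrank ℝ S + Module.finrank ℝ L < n ∧ ∃ Γ ∈ limitSupports 𝔉 L, S = projSpan L Γ}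

/-- `μ₀ + S`, as a set. -/
def shift {n : ℕ} (μ₀ : EuclideanSpace ℝ (Fin n)) (S : Submodule ℝ (EuclideanSpace ℝ (Fin n))) :
    Set (EuclideanSpace ℝ (Fin n)) :=
  (fun s => μ₀ + s) '' (S : Set (EuclideanSpace ℝ (Fin n)))

end SizeControl

end

noncomputable section

namespace SizeControl

/-! Argue by contradiction. If no critical value works for some `α`, then for every natural number
`j` there are a null mean, a scale and a density in `𝔉` under which `j ≤ T` has probability above
`α`. By invariance of `T`, each such law may be replaced by the image of a standard Gaussian under
`z ↦ μ₀ + D_j z`, where `D_j` is any nonzero multiple of the projection onto `Lᗮ` composed with the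
square root of the covariance matrix. With a suitable multiple a subsequence of the `D_j` converges
to some `D` (`exists_limit_map`), and the range of `D` decides the case. If the range is all of
`Lᗮ`, then `D_j = D ∘ U_j` with `U_j` tending to the identity. The probabilities tend to zero
because the sets where `j ≤ T` decrease to the empty set; continuity of `T` plays no role. If the
range is smaller, it belongs to `relevantSubspaces`, so the limit law gives `N` probability zero; `T
(μ₀ + D_j z)` then converges almost surely to a finite value and cannot exceed `j` in the limit.
Both contradict the lower bound `α`. The limit is identified through polynomials. Attach to `x` the
polynomial `p_x` with coefficients `x_j`; the quadratic form of `Σ(f)` at `x` is the integral of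
`|p_x|² f` over the unit circle. For `x ∈ Lᗮ` one has `p_x = Δ_L Q_x`, so after normalization the
form is the integral of `|Q_x|²` against the filtered measure and passes to a weak limit `m`. It
vanishes in the limit exactly when `Q_x` is zero on the support of `m`, that is, when `x` is
orthogonal to `projSpan L Γ`. If this happens for some nonzero `x ∈ Lᗮ`, then the support is finite
and the degree of `Q_x` yields the weight condition in `limitMeasures`. -/

/-! ### Gaussian probabilities under converging linear maps. -/

theorem gaussianReal_le_volume : gaussianReal 0 1 ≤ volume := by
  rw [gaussianReal_of_var_ne_zero 0 one_ne_zero]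
  conv_rhs => rw [← withDensity_one (μ := (volume : Measure ℝ))]
  refine withDensity_mono (Eventually.of_forall fun x => ?_)
  simp only [gaussianPDF, gaussianPDFReal, Pi.one_apply]
  rw [ENNReal.ofReal_le_one]
  have h1 : (1 : ℝ) ≤ √(2 * Real.pi * (1 : NNReal)) := by
    rw [Real.one_le_sqrt]; have := Real.pi_gt_three; push_cast; linarith
  have h2 : Real.exp (-(x - 0) ^ 2 / (2 * (1 : NNReal))) ≤ 1 := by
    rw [Real.exp_le_one_iff]; push_cast; nlinarith [sq_nonneg (x - 0)]
  exact mul_le_one₀ (inv_le_one_of_one_le₀ h1) (Real.exp_nonneg _) h2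

/-- `OuterMeasure.pi` is the largest outer measure dominated by the product on boxes, so a
comparison on boxes extends to all measurable sets. -/
theorem pi_le_pi {ι : Type*} [Fintype ι] {α : ι → Type*} [∀ i, MeasurableSpace (α i)]
    {μ ν : ∀ i, Measure (α i)} [∀ i, SigmaFinite (μ i)] (h : ∀ i, μ i ≤ ν i) :
    Measure.pi μ ≤ Measure.pi ν := by
  refine Measure.le_iff.2 fun s hs => ?_
  have h1 : (Measure.pi μ).toOuterMeasure ≤
      OuterMeasure.pi fun i => (ν i).toOuterMeasure := by
    rw [OuterMeasure.le_pi]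
    intro t _
    change Measure.pi μ (univ.pi t) ≤ _
    rw [Measure.pi_pi]
    exact Finset.prod_le_prod' fun i _ => h i (t i)
  calc Measure.pi μ s ≤ OuterMeasure.pi (fun i => (ν i).toOuterMeasure) s := h1 s
    _ = Measure.pi ν s := by rw [Measure.pi, toMeasure_apply _ _ hs]

theorem stdGaussian_le_volume (n : ℕ) :
    stdGaussian (EuclideanSpace ℝ (Fin n)) ≤ volume := by
  rw [← map_pi_eq_stdGaussian, ← (EuclideanSpace.volume_preserving_symm_measurableEquiv_toLp
    (Fin n)).symm.map_eq]
  refine Measure.map_mono ?_ (by fun_prop)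
  rw [volume_pi]
  exact pi_le_pi fun _ => gaussianReal_le_volume

/-- Gaussian measures of preimages under maps tending to the identity, of decreasing sets with
empty intersection, tend to zero. -/
theorem tendsto_stdGaussian_preimage_of_tendsto_id {n : ℕ}
    {W : ℕ → Set (EuclideanSpace ℝ (Fin n))} (hW : Antitone W)
    (hWm : ∀ j, MeasurableSet (W j)) (hWe : ⋂ j, W j = ∅)
    {U : ℕ → EuclideanSpace ℝ (Fin n) →L[ℝ] EuclideanSpace ℝ (Fin n)}
    (hU : Tendsto U atTop (𝓝 (ContinuousLinearMap.id ℝ _))) :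
    Tendsto (fun j => stdGaussian (EuclideanSpace ℝ (Fin n)) (U j ⁻¹' W j)) atTop (𝓝 0) := by
  set γ := stdGaussian (EuclideanSpace ℝ (Fin n)) with hγ
  rw [ENNReal.tendsto_nhds_zero]
  intro ε hε
  have hball : Tendsto (fun r : ℕ => γ (Metric.closedBall 0 (r : ℝ))ᶜ) atTop (𝓝 0) := by
    have := tendsto_measure_iInter_atTop (μ := γ)
      (s := fun r : ℕ => (Metric.closedBall (0 : EuclideanSpace ℝ (Fin n)) (r : ℝ))ᶜ)
      (fun r => Metric.isClosed_closedBall.measurableSet.compl.nullMeasurableSet)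
      (fun a b hab => compl_subset_compl.2 (Metric.closedBall_subset_closedBall
        (by exact_mod_cast hab))) ⟨0, measure_ne_top _ _⟩
    rwa [← compl_iUnion, Metric.iUnion_closedBall_nat, compl_univ, measure_empty] at this
  obtain ⟨r, hr⟩ := (ENNReal.tendsto_nhds_zero.1 hball (ε / 2) (ENNReal.half_pos hε.ne')).exists
  have hdet : Tendsto (fun j => ENNReal.ofReal |(LinearMap.det (U j).toLinearMap)⁻¹|)
      atTop (𝓝 1) := by
    have hc : Tendsto (fun j => (U j).det) atTop (𝓝 1) := by
      have := (ContinuousLinearMap.continuous_det (𝕜 := ℝ)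
        (E := EuclideanSpace ℝ (Fin n))).tendsto (ContinuousLinearMap.id ℝ _)
      have h1 : (ContinuousLinearMap.id ℝ (EuclideanSpace ℝ (Fin n))).det = 1 := by
        simp [ContinuousLinearMap.det]
      rw [h1] at this
      exact this.comp hU
    have := ENNReal.tendsto_ofReal ((hc.inv₀ one_ne_zero).abs)
    simpa using this
  -- The radius `2 r` is enough: up to `ε / 2` of Gaussian mass, `‖z‖ ≤ r`, and `‖U j - id‖ ≤ 1`
  -- then gives `‖U j z‖ ≤ 2 r`. The truncation makes the volumes finite, as continuity from above
  -- requires.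
  have hvol : Tendsto (fun j => volume (W j ∩ Metric.closedBall 0 (2 * (r : ℝ)))) atTop (𝓝 0) := by
    have := tendsto_measure_iInter_atTop
      (μ := (volume : Measure (EuclideanSpace ℝ (Fin n))))
      (s := fun j => W j ∩ Metric.closedBall 0 (2 * (r : ℝ)))
      (fun j => ((hWm j).inter Metric.isClosed_closedBall.measurableSet).nullMeasurableSet)
      (fun a b hab => inter_subset_inter_left _ (hW hab))
      ⟨0, ((measure_mono inter_subset_right).trans_lt
        (isCompact_closedBall _ _).measure_lt_top).ne⟩
    rwa [← iInter_inter, hWe, empty_inter, measure_empty] at this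
  have hprod := ENNReal.Tendsto.mul hdet (Or.inl one_ne_zero) hvol (Or.inr ENNReal.one_ne_top)
  rw [one_mul] at hprod
  have hdet0 : ∀ᶠ j in atTop, LinearMap.det (U j).toLinearMap ≠ 0 := by
    have h := (hdet.eventually (lt_mem_nhds (zero_lt_one' ENNReal)))
    filter_upwards [h] with j hj h0
    simp [h0] at hj
  have hnorm : ∀ᶠ j in atTop, ‖U j - ContinuousLinearMap.id ℝ _‖ ≤ 1 := by
    have := tendsto_iff_norm_sub_tendsto_zero.1 hU
    exact (this.eventually (ge_mem_nhds zero_lt_one))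
  filter_upwards [hdet0, hnorm, ENNReal.tendsto_nhds_zero.1 hprod (ε / 2)
    (ENNReal.half_pos hε.ne')] with j h0 hn hp
  have hsub : U j ⁻¹' W j ⊆ (Metric.closedBall 0 (r : ℝ))ᶜ ∪
      (U j).toLinearMap ⁻¹' (W j ∩ Metric.closedBall 0 (2 * (r : ℝ))) := by
    intro z hz
    by_cases hzr : z ∈ Metric.closedBall (0 : EuclideanSpace ℝ (Fin n)) (r : ℝ)
    · refine Or.inr ⟨hz, ?_⟩
      rw [mem_closedBall_zero_iff] at hzr ⊢
      have h2 := (U j - ContinuousLinearMap.id ℝ (EuclideanSpace ℝ (Fin n))).le_opNorm z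
      have h3 : ‖U j z‖ ≤ ‖U j z - z‖ + ‖z‖ := by
        simpa using norm_add_le (U j z - z) z
      rw [_root_.sub_apply, ContinuousLinearMap.id_apply] at h2
      have h4 := mul_le_mul_of_nonneg_right hn (norm_nonneg z)
      change ‖U j z‖ ≤ _
      linarith
    · exact Or.inl hzr
  calc γ (U j ⁻¹' W j) ≤ γ (Metric.closedBall 0 (r : ℝ))ᶜ +
        γ ((U j).toLinearMap ⁻¹' (W j ∩ Metric.closedBall 0 (2 * (r : ℝ)))) :=
        (measure_mono hsub).trans (measure_union_le _ _)
    _ ≤ ε / 2 + volume ((U j).toLinearMap ⁻¹' (W j ∩ Metric.closedBall 0 (2 * (r : ℝ)))) := by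
        gcongr
        exact stdGaussian_le_volume n
    _ ≤ ε / 2 + ε / 2 := by
        rw [Measure.addHaar_preimage_linearMap _ h0]
        gcongr
    _ = ε := ENNReal.add_halves ε

/-- Gaussian measures of preimages under linear maps tending to a linear map of at least the same
range, of decreasing sets with empty intersection, tend to zero. -/
theorem tendsto_stdGaussian_preimage_of_range_le {n : ℕ}
    {W : ℕ → Set (EuclideanSpace ℝ (Fin n))} (hW : Antitone W)
    (hWm : ∀ j, MeasurableSet (W j)) (hWe : ⋂ j, W j = ∅)
    {D : ℕ → EuclideanSpace ℝ (Fin n) →L[ℝ] EuclideanSpace ℝ (Fin n)}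
    {D₀ : EuclideanSpace ℝ (Fin n) →L[ℝ] EuclideanSpace ℝ (Fin n)}
    (hD : Tendsto D atTop (𝓝 D₀)) (hr : ∀ j z, ∃ y, D₀ y = D j z) :
    Tendsto (fun j => stdGaussian (EuclideanSpace ℝ (Fin n)) (D j ⁻¹' W j)) atTop (𝓝 0) := by
  -- `s` is a section of `D₀` over its range, extended linearly to the whole space. As `D j - D₀`
  -- takes values in that range, `U j = id + s (D j - D₀)` satisfies `D₀ ∘ U j = D j` and tends to
  -- the identity.
  obtain ⟨s, hs⟩ : ∃ s : EuclideanSpace ℝ (Fin n) →L[ℝ] EuclideanSpace ℝ (Fin n),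
      ∀ y, D₀ (s (D₀ y)) = D₀ y := by
    obtain ⟨g, hg⟩ := D₀.toLinearMap.rangeRestrict.exists_rightInverse_of_surjective
      (LinearMap.range_rangeRestrict _)
    obtain ⟨h, hh⟩ := LinearMap.exists_extend g
    refine ⟨LinearMap.toContinuousLinearMap h, fun y => ?_⟩
    have h1 := LinearMap.congr_fun hh (D₀.toLinearMap.rangeRestrict y)
    have h2 := LinearMap.congr_fun hg (D₀.toLinearMap.rangeRestrict y)
    have h3 := congrArg Subtype.val h2
    simp only [LinearMap.comp_apply, Submodule.subtype_apply] at h1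
    simp only [LinearMap.comp_apply, LinearMap.id_apply] at h3
    rw [← h1] at h3
    exact h3
  set U : ℕ → EuclideanSpace ℝ (Fin n) →L[ℝ] EuclideanSpace ℝ (Fin n) :=
    fun j => ContinuousLinearMap.id ℝ _ + s ∘L (D j - D₀) with hUdef
  have hU : Tendsto U atTop (𝓝 (ContinuousLinearMap.id ℝ _)) := by
    have h1 : Tendsto (fun j => D j - D₀) atTop (𝓝 0) := by
      simpa using hD.sub_const D₀
    have h2 : Tendsto (fun j => s ∘L (D j - D₀)) atTop (𝓝 (s ∘L 0)) :=
      ((ContinuousLinearMap.compL ℝ _ _ _ s).continuous.tendsto 0).comp h1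
    have h3 := h2.const_add (ContinuousLinearMap.id ℝ (EuclideanSpace ℝ (Fin n)))
    rwa [ContinuousLinearMap.comp_zero, add_zero] at h3
  have hDU : ∀ j z, D₀ (U j z) = D j z := by
    intro j z
    obtain ⟨y, hy⟩ := hr j z
    have : D j z - D₀ z = D₀ (y - z) := by rw [map_sub, hy]
    have h1 : U j z = z + s (D j z - D₀ z) := rfl
    rw [h1, map_add, this, hs, map_sub, hy, add_sub_cancel]
  have := tendsto_stdGaussian_preimage_of_tendsto_id (W := fun j => D₀ ⁻¹' W j)
    (fun a b hab => preimage_mono (hW hab)) (fun j => D₀.continuous.measurable (hWm j))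
    (by rw [← preimage_iInter, hWe, preimage_empty]) hU
  refine this.congr fun j => ?_
  congr 1
  ext z
  simp [hDU]

/-- If the limit map avoids the closed discontinuity set almost surely, then the Gaussian
probabilities of `j ≤ T` tend to zero. -/
theorem tendsto_stdGaussian_of_ae_notMem {n : ℕ}
    {T : EuclideanSpace ℝ (Fin n) → ℝ} (hT : Measurable T)
    {N : Set (EuclideanSpace ℝ (Fin n))} (hN : IsClosed N) (hTN : ContinuousOn T Nᶜ)
    {D : ℕ → EuclideanSpace ℝ (Fin n) →L[ℝ] EuclideanSpace ℝ (Fin n)}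
    {D₀ : EuclideanSpace ℝ (Fin n) →L[ℝ] EuclideanSpace ℝ (Fin n)}
    (hD : Tendsto D atTop (𝓝 D₀)) (μ₀ : EuclideanSpace ℝ (Fin n))
    (h0 : ∀ᵐ z ∂stdGaussian (EuclideanSpace ℝ (Fin n)), μ₀ + D₀ z ∉ N) :
    Tendsto (fun j : ℕ => stdGaussian (EuclideanSpace ℝ (Fin n)) {z | (j : ℝ) ≤ T (μ₀ + D j z)})
      atTop (𝓝 0) := by
  have key := tendsto_measure_of_ae_tendsto_indicator
    (μ := stdGaussian (EuclideanSpace ℝ (Fin n))) (L := atTop) (A := ∅)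
    (As := fun j : ℕ => {z | (j : ℝ) ≤ T (μ₀ + D j z)}) (B := univ)
    MeasurableSet.empty ?_ MeasurableSet.univ (measure_ne_top _ _)
    (Eventually.of_forall fun _ => subset_univ _) ?_
  · simpa using key
  · intro j
    exact measurableSet_le measurable_const
      (hT.comp ((D j).continuous.measurable.const_add μ₀))
  · filter_upwards [h0] with z hz
    have h1 : Tendsto (fun j => μ₀ + D j z) atTop (𝓝 (μ₀ + D₀ z)) :=
      (((ContinuousLinearMap.apply ℝ _ z).continuous.tendsto D₀).comp hD).const_add μ₀
    have h2 := ((hTN.continuousAt (hN.isOpen_compl.mem_nhds hz)).tendsto).comp h1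
    have h3 := h2.eventually (gt_mem_nhds (lt_add_one (T (μ₀ + D₀ z))))
    have h4 := tendsto_natCast_atTop_atTop.eventually_ge_atTop (T (μ₀ + D₀ z) + 1)
    filter_upwards [h3, h4] with j h3 h4
    simp only [Function.comp_apply] at h3
    simp only [mem_empty_iff_false, iff_false, not_le]
    linarith

/-- The Gaussian is absolutely continuous, and a surjective linear map pulls Lebesgue null sets back
to null sets; this is applied to `D₀` as a map onto its range. -/
theorem ae_notMem_of_affineLebesgue_eq_zero {n : ℕ} {N : Set (EuclideanSpace ℝ (Fin n))}
    (hN : IsClosed N) (D₀ : EuclideanSpace ℝ (Fin n) →L[ℝ] EuclideanSpace ℝ (Fin n))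
    {μ₀ : EuclideanSpace ℝ (Fin n)} {S : Submodule ℝ (EuclideanSpace ℝ (Fin n))}
    (hS : D₀.toLinearMap.range = S) (h : affineLebesgue μ₀ S N = 0) :
    ∀ᵐ z ∂stdGaussian (EuclideanSpace ℝ (Fin n)), μ₀ + D₀ z ∉ N := by
  subst hS
  refine (Measure.absolutelyContinuous_of_le (stdGaussian_le_volume n)).ae_le ?_
  set f : D₀.toLinearMap.range → EuclideanSpace ℝ (Fin n) := fun s => μ₀ + (s : _) with hf
  have hfm : Measurable f := measurable_subtype_coe.const_add μ₀
  rw [affineLebesgue, Measure.map_apply hfm hN.measurableSet] at h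
  have hm : MeasurableSet (f ⁻¹' N)ᶜ := (hfm hN.measurableSet).compl
  exact (ae_comp_linearMap_mem_iff (D₀.toLinearMap.rangeRestrict) volume
    ((stdOrthonormalBasis ℝ D₀.toLinearMap.range).toBasis.addHaar)
    (LinearMap.surjective_rangeRestrict _) hm).2 (measure_eq_zero_iff_ae_notMem.1 h)

/-- Convergent norms are bounded at each point, hence the operators are uniformly bounded, and
bounded sets of operators are relatively compact in finite dimension. -/
theorem exists_tendsto_subseq_of_norm_apply_tendsto {n : ℕ}
    (A : ℕ → EuclideanSpace ℝ (Fin n) →L[ℝ] EuclideanSpace ℝ (Fin n))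
    (Q : EuclideanSpace ℝ (Fin n) → ℝ)
    (h : ∀ x, Tendsto (fun j => ‖A j x‖ ^ 2) atTop (𝓝 (Q x))) :
    ∃ (φ : ℕ → ℕ) (A₀ : EuclideanSpace ℝ (Fin n) →L[ℝ] EuclideanSpace ℝ (Fin n)),
      StrictMono φ ∧ Tendsto (A ∘ φ) atTop (𝓝 A₀) ∧ ∀ x, ‖A₀ x‖ ^ 2 = Q x := by
  obtain ⟨C, hC⟩ := banach_steinhaus (g := A) fun x => by
    obtain ⟨C, hC⟩ := (h x).bddAbove_range
    refine ⟨√C, fun j => Real.le_sqrt_of_sq_le (hC ⟨j, rfl⟩)⟩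
  obtain ⟨A₀, -, φ, hφ, hlim⟩ := tendsto_subseq_of_bounded (x := A)
    (Metric.isBounded_closedBall (x := 0) (r := C)) (fun j => by simpa using hC j)
  refine ⟨φ, A₀, hφ, hlim, fun x => ?_⟩
  have h1 := ((((ContinuousLinearMap.apply ℝ _ x).continuous.tendsto A₀).comp hlim).norm).pow 2
  exact tendsto_nhds_unique h1 ((h x).comp hφ.tendsto_atTop)

/-! ### Coefficient polynomials and their zeros on the unit circle. -/

open Polynomial

/-- The Euler operator `z d/dz` on polynomials. -/
def euler {K : Type*} [Semiring K] (p : K[X]) : K[X] := X * derivative p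

/-- Each application of `z d/dz` lowers the order of the zero at `a` by one and brings out `a` times
the order, whence the factor `a ^ d * d!`. -/
theorem euler_iterate_eval {K : Type*} [Field K] (a : K) (d : ℕ) (r : K[X]) :
    (euler^[d] ((X - C a) ^ d * r)).eval a = a ^ d * d.factorial * r.eval a := by
  induction d generalizing r with
  | zero => simp
  | succ d ih =>
    have h : euler ((X - C a) ^ (d + 1) * r) =
        (X - C a) ^ d * ((C ((d : K) + 1)) * X * r + (X - C a) * X * derivative r) := by
      simp only [euler, derivative_mul, derivative_X_sub_C_pow, Nat.cast_add, Nat.cast_one, map_add,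
        map_one, map_natCast, Nat.add_sub_cancel]
      ring
    rw [Function.iterate_succ_apply, h, ih]
    simp [Nat.factorial_succ]
    ring

theorem X_sub_C_pow_dvd_of_euler {K : Type*} [Field K] [CharZero K] {a : K} (ha : a ≠ 0) {p : K[X]}
    {d : ℕ} (h : ∀ s < d, (euler^[s] p).eval a = 0) : (X - C a) ^ d ∣ p := by
  induction d with
  | zero => simp
  | succ d ih =>
    obtain ⟨r, hr⟩ := ih fun s hs => h s (hs.trans d.lt_succ_self)
    have h1 := h d d.lt_succ_self
    rw [hr, euler_iterate_eval] at h1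
    have h2 : r.eval a = 0 := by
      simpa [ha, Nat.factorial_ne_zero] using h1
    obtain ⟨t, ht⟩ := dvd_iff_isRoot.2 h2
    exact ⟨t, by rw [hr, ht]; ring⟩

/-- The polynomial `∑ x_j z ^ j`, `1 ≤ j ≤ n`. -/
def coeffPoly {n : ℕ} (x : EuclideanSpace ℝ (Fin n)) : ℝ[X] :=
  ∑ i : Fin n, monomial ((i : ℕ) + 1) (x i)

theorem natDegree_coeffPoly_le {n : ℕ} (x : EuclideanSpace ℝ (Fin n)) :
    (coeffPoly x).natDegree ≤ n :=
  natDegree_sum_le_of_forall_le _ _ fun i _ => (natDegree_monomial_le _).trans i.2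

theorem coeffPoly_ne_zero {n : ℕ} {x : EuclideanSpace ℝ (Fin n)} (hx : x ≠ 0) :
    coeffPoly x ≠ 0 := by
  contrapose! hx
  ext i
  have := congrArg (fun p => p.coeff ((i : ℕ) + 1)) hx
  simpa [coeffPoly, finsetSum_coeff, coeff_monomial, Fin.val_inj] using this

/-- Exponents run from `1` to `n`. The resulting root at `0` is what later makes the degree
inequality strict. -/
theorem coeff_zero_coeffPoly {n : ℕ} (x : EuclideanSpace ℝ (Fin n)) :
    (coeffPoly x).coeff 0 = 0 := by
  simp [coeffPoly, finsetSum_coeff, coeff_monomial]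

/-- The `c`-th column of `trigMatrix n s ω`. -/
def trigCol (n s : ℕ) (ω : ℝ) (c : Fin 2) : EuclideanSpace ℝ (Fin n) :=
  WithLp.toLp 2 fun i => trigMatrix n s ω i c

theorem euler_iterate_map_coeffPoly {n : ℕ} (x : EuclideanSpace ℝ (Fin n)) (s : ℕ) :
    euler^[s] ((coeffPoly x).map Complex.ofRealHom) =
      ∑ i : Fin n, monomial ((i : ℕ) + 1) ((((i : ℕ) + 1 : ℝ) ^ s * x i : ℝ) : ℂ) := by
  induction s with
  | zero => simp [coeffPoly, Polynomial.map_sum]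
  | succ s ih =>
    rw [Function.iterate_succ_apply', ih]
    simp only [euler, derivative_sum, Finset.mul_sum]
    refine Finset.sum_congr rfl fun i _ => ?_
    rw [derivative_monomial, X_mul_monomial, Nat.add_sub_cancel]
    congr 1
    push_cast
    ring

theorem exp_pow_eq (ω : ℝ) (m : ℕ) :
    Complex.exp (Complex.I * ω) ^ m =
      (Real.cos (m * ω) : ℂ) + (Real.sin (m * ω) : ℂ) * Complex.I := by
  rw [← Complex.exp_nat_mul, Complex.ofReal_cos, Complex.ofReal_sin, ← Complex.exp_mul_I]
  congr 1
  push_cast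
  ring

/-- The operator `z d/dz` iterated `s` times multiplies the coefficient of `z ^ j` by `j ^ s`, the
weight in `trigMatrix`. Orthogonality to trigonometric columns thereby becomes vanishing at `exp (ι
ω)`. -/
theorem eval_euler_iterate_coeffPoly {n : ℕ} (x : EuclideanSpace ℝ (Fin n)) (s : ℕ) (ω : ℝ) :
    (euler^[s] ((coeffPoly x).map Complex.ofRealHom)).eval (Complex.exp (Complex.I * ω)) =
      (inner ℝ x (trigCol n s ω 0) : ℂ) + (inner ℝ x (trigCol n s ω 1) : ℂ) * Complex.I := by
  rw [euler_iterate_map_coeffPoly, eval_finsetSum]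
  simp only [eval_monomial, exp_pow_eq, PiLp.inner_apply, trigCol, trigMatrix, Matrix.of_apply,
    Complex.ofReal_sum, Finset.sum_mul, ← Finset.sum_add_distrib]
  refine Finset.sum_congr rfl fun i _ => ?_
  simp
  ring

theorem eval_euler_iterate_coeffPoly_eq_zero_iff {n : ℕ} (x : EuclideanSpace ℝ (Fin n)) (s : ℕ)
    (ω : ℝ) :
    (euler^[s] ((coeffPoly x).map Complex.ofRealHom)).eval (Complex.exp (Complex.I * ω)) = 0 ↔
      ∀ c, inner ℝ x (trigCol n s ω c) = 0 := by
  rw [eval_euler_iterate_coeffPoly, Fin.forall_fin_two, Complex.ext_iff]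
  simp

theorem inner_trigCol_eq_zero_of_lt_rho {n : ℕ} {L : Submodule ℝ (EuclideanSpace ℝ (Fin n))}
    {x : EuclideanSpace ℝ (Fin n)} (hx : x ∈ Lᗮ) {s : ℕ} {ω : ℝ} (hs : s < rho ω L) (c : Fin 2) :
    inner ℝ x (trigCol n s ω c) = 0 := by
  have h := Nat.notMem_of_lt_sInf hs
  have hc : trigCol n s ω c ∈ L := by
    have h' : colSpan (trigMatrix n s ω) ≤ L := by simpa using h
    exact h' (Submodule.subset_span ⟨c, rfl⟩)
  exact Submodule.inner_left_of_mem_orthogonal hc hx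

theorem X_sub_C_pow_rho_dvd {n : ℕ} {L : Submodule ℝ (EuclideanSpace ℝ (Fin n))}
    {x : EuclideanSpace ℝ (Fin n)} (hx : x ∈ Lᗮ) (ω : ℝ) :
    (X - C (Complex.exp (Complex.I * ω))) ^ rho ω L ∣ (coeffPoly x).map Complex.ofRealHom :=
  X_sub_C_pow_dvd_of_euler (Complex.exp_ne_zero _) fun _ hs =>
    (eval_euler_iterate_coeffPoly_eq_zero_iff _ _ _).2
      fun c => inner_trigCol_eq_zero_of_lt_rho hx hs c

theorem exists_orthogonal_ne_zero {n : ℕ} {L : Submodule ℝ (EuclideanSpace ℝ (Fin n))}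
    (hL : Module.finrank ℝ L < n) : ∃ x ∈ Lᗮ, x ≠ 0 := by
  refine (Submodule.ne_bot_iff _).1 fun h => ?_
  rw [Submodule.orthogonal_eq_bot_iff] at h
  rw [h, finrank_top, finrank_euclideanSpace_fin] at hL
  exact hL.ne rfl

/-! ### The factors `Δ_ω` and divisibility by `Δ_L`. -/

theorem quadr_eval (c : ℝ) (ν : ℝ) :
    ((1 - C (2 * c) * X + X ^ 2 : ℝ[X]).map Complex.ofRealHom).eval (Complex.exp (Complex.I * ν)) =
      2 * Complex.exp (Complex.I * ν) * ((Real.cos ν - c : ℝ) : ℂ) := by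
  have h : ((Real.cos ν : ℝ) : ℂ) =
      (Complex.exp (Complex.I * ν) + (Complex.exp (Complex.I * ν))⁻¹) / 2 := by
    rw [Complex.ofReal_cos, Complex.cos, ← Complex.exp_neg]
    congr 3 <;> ring_nf
  rw [Complex.ofReal_sub, h]
  have := Complex.exp_ne_zero (Complex.I * ν)
  simp
  field_simp
  ring

theorem diffFactor_eq_or (ω : ℝ) :
    diffFactor ω = 1 - C (2 * Real.cos ω) * X + X ^ 2 ∨
      (ω = 0 ∨ ω = Real.pi) ∧ Real.cos ω * Real.cos ω = 1 ∧
        diffFactor ω = 1 - C (Real.cos ω) * X := by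
  unfold diffFactor
  split_ifs with h
  · refine Or.inr ⟨h, ?_, rfl⟩
    rcases h with rfl | rfl <;> simp
  · exact Or.inl rfl

/-- For `ω ∈ {0, π}` the quadratic is the square of the linear factor, because `cos² ω = 1`.
Coprimality can then be proved for quadratics only, with no case distinction. -/
theorem diffFactor_dvd (ω : ℝ) : diffFactor ω ∣ 1 - C (2 * Real.cos ω) * X + X ^ 2 := by
  rcases diffFactor_eq_or ω with h | ⟨-, h1, h⟩
  · rw [h]
  · refine ⟨diffFactor ω, ?_⟩
    rw [h]
    have : (C (Real.cos ω) * C (Real.cos ω) : ℝ[X]) = 1 := by rw [← C_mul, h1, C_1]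
    rw [C_mul, show (C 2 : ℝ[X]) = 2 from rfl]
    linear_combination (-(X ^ 2 : ℝ[X])) * this

theorem isCoprime_X_quadr (c : ℝ) : IsCoprime (X : ℝ[X]) (1 - C (2 * c) * X + X ^ 2) :=
  ⟨C (2 * c) - X, 1, by ring⟩

/-- The two quadratics differ by a nonzero constant times `X`, and each of them is coprime to `X`.
-/
theorem isCoprime_quadr {c c' : ℝ} (h : c ≠ c') :
    IsCoprime (1 - C (2 * c) * X + X ^ 2 : ℝ[X]) (1 - C (2 * c') * X + X ^ 2) := by
  have h1 : IsCoprime (1 - C (2 * c) * X + X ^ 2 : ℝ[X]) (C (2 * (c - c')) * X) := by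
    refine IsCoprime.mul_right ?_ (isCoprime_X_quadr c).symm
    exact isCoprime_one_right.of_isCoprime_of_dvd_right
      (isUnit_C.2 (IsUnit.mk0 _ (mul_ne_zero two_ne_zero (sub_ne_zero.2 h)))).dvd
  have h2 : (1 - C (2 * c') * X + X ^ 2 : ℝ[X]) =
      C (2 * (c - c')) * X + (1 - C (2 * c) * X + X ^ 2) * 1 := by
    simp only [C_mul, C_sub]
    ring
  rw [h2]
  exact (IsCoprime.add_mul_left_right_iff).2 h1

theorem isCoprime_diffFactor {ω ω' : ℝ} (h : Real.cos ω ≠ Real.cos ω') :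
    IsCoprime (diffFactor ω) (diffFactor ω') :=
  ((isCoprime_quadr h).of_isCoprime_of_dvd_left (diffFactor_dvd ω)).of_isCoprime_of_dvd_right
    (diffFactor_dvd ω')

theorem isCoprime_X_diffFactor (ω : ℝ) : IsCoprime X (diffFactor ω) :=
  (isCoprime_X_quadr _).of_isCoprime_of_dvd_right (diffFactor_dvd ω)

theorem diffFactor_eval_zero (ω : ℝ) : (diffFactor ω).eval 0 = 1 := by
  rcases diffFactor_eq_or ω with h | ⟨-, -, h⟩ <;> simp [h]

theorem diffFactor_ne_zero (ω : ℝ) : diffFactor ω ≠ 0 := by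
  intro h
  simpa [h] using diffFactor_eval_zero ω

theorem natDegree_diffFactor (ω : ℝ) : (diffFactor ω).natDegree = kappa ω 1 := by
  unfold diffFactor kappa
  split_ifs with h
  · have : Real.cos ω ≠ 0 := by rcases h with rfl | rfl <;> simp
    rw [sub_eq_add_neg, add_comm, ← neg_mul, ← C_neg]
    compute_degree!
  · compute_degree!

theorem kappa_eq_mul (ω : ℝ) (d : ℕ) : kappa ω d = d * kappa ω 1 := by
  unfold kappa
  split_ifs <;> omega

theorem cos_eq_of_diffFactor_eval_eq_zero {ω ν : ℝ}
    (h : ((diffFactor ω).map Complex.ofRealHom).eval (Complex.exp (Complex.I * ν)) = 0) :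
    Real.cos ν = Real.cos ω := by
  have h1 := eval_dvd (x := Complex.exp (Complex.I * ν))
    (Polynomial.map_dvd Complex.ofRealHom (diffFactor_dvd ω))
  rw [h, zero_dvd_iff, quadr_eval] at h1
  have h2 : ((Real.cos ν - Real.cos ω : ℝ) : ℂ) = 0 := by
    simpa [Complex.exp_ne_zero] using h1
  exact sub_eq_zero.1 (Complex.ofReal_eq_zero.1 h2)

theorem conj_exp (ω : ℝ) : (starRingEnd ℂ) (Complex.exp (Complex.I * ω)) =
    (Complex.exp (Complex.I * ω))⁻¹ := by
  rw [← Complex.exp_conj, ← Complex.exp_neg]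
  simp

theorem map_quadr_eq (ω : ℝ) :
    (1 - C (2 * Real.cos ω) * X + X ^ 2 : ℝ[X]).map Complex.ofRealHom =
      (X - C (Complex.exp (Complex.I * ω))) * (X - C (Complex.exp (Complex.I * ω))⁻¹) := by
  have h : (((2 * Real.cos ω : ℝ)) : ℂ) =
      Complex.exp (Complex.I * ω) + (Complex.exp (Complex.I * ω))⁻¹ := by
    rw [Complex.ofReal_mul, Complex.ofReal_cos, Complex.cos, ← Complex.exp_neg]
    ring_nf
    push_cast
    ring
  have h1 : (C (Complex.exp (Complex.I * ω)) * C (Complex.exp (Complex.I * ω))⁻¹ : ℂ[X]) = 1 := by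
    rw [← C_mul, mul_inv_cancel₀ (Complex.exp_ne_zero _), C_1]
  simp only [Polynomial.map_add, Polynomial.map_sub, Polynomial.map_mul, Polynomial.map_one,
    Polynomial.map_pow, map_X, map_C, Complex.ofRealHom_eq_coe, h, C_add]
  linear_combination -h1

theorem exp_mul_I_eq_cos {ω : ℝ} (h : ω = 0 ∨ ω = Real.pi) :
    Complex.exp (Complex.I * ω) = (Real.cos ω : ℂ) := by
  rcases h with rfl | rfl
  · simp
  · rw [mul_comm, Complex.exp_pi_mul_I]; simp

theorem exp_ne_inv {ω : ℝ} (hω : ω ∈ Icc 0 Real.pi) (h : ¬ (ω = 0 ∨ ω = Real.pi)) :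
    Complex.exp (Complex.I * ω) ≠ (Complex.exp (Complex.I * ω))⁻¹ := by
  rw [← conj_exp]
  intro h1
  have h2 := Complex.conj_eq_iff_im.1 h1.symm
  rw [mul_comm, Complex.exp_ofReal_mul_I_im] at h2
  push Not at h
  exact (Real.sin_pos_of_pos_of_lt_pi (lt_of_le_of_ne hω.1 h.1.symm)
    (lt_of_le_of_ne hω.2 h.2)).ne' h2

/-- A real polynomial with a root of order `d` at `exp (ι ω)` is divisible by `Δ_ω ^ d`. -/
theorem diffFactor_pow_dvd {p : ℝ[X]} {ω : ℝ} (hω : ω ∈ Icc 0 Real.pi) {d : ℕ}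
    (h : (X - C (Complex.exp (Complex.I * ω))) ^ d ∣ p.map Complex.ofRealHom) :
    diffFactor ω ^ d ∣ p := by
  by_cases hc : ω = 0 ∨ ω = Real.pi
  · have h1 : (X - C (Real.cos ω)) ^ d ∣ p := by
      rw [exp_mul_I_eq_cos hc] at h
      refine (map_dvd_map Complex.ofRealHom (RingHom.injective _)
        ((monic_X_sub_C _).pow d)).1 ?_
      simpa using h
    refine (pow_dvd_pow_of_dvd ⟨C (-Real.cos ω), ?_⟩ d).trans h1
    have h2 : Real.cos ω * Real.cos ω = 1 := by rcases hc with rfl | rfl <;> simp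
    have h3 : (C (Real.cos ω) * C (Real.cos ω) : ℝ[X]) = 1 := by rw [← C_mul, h2, C_1]
    rw [diffFactor, if_pos hc, C_neg]
    linear_combination (-X : ℝ[X]) * h3
  -- Real coefficients force a zero of the same order at the conjugate point, which is distinct from
  -- `exp (ι ω)` for `ω` inside `(0, π)`.
  · have h1 : (X - C (Complex.exp (Complex.I * ω))⁻¹) ^ d ∣ p.map Complex.ofRealHom := by
      have h2 := Polynomial.map_dvd (starRingEnd ℂ) h
      have h3 : (p.map Complex.ofRealHom).map (starRingEnd ℂ) = p.map Complex.ofRealHom := by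
        rw [Polynomial.map_map]
        congr 1
        ext x
        simp
      rw [h3, Polynomial.map_pow, Polynomial.map_sub, map_X, map_C, conj_exp] at h2
      exact h2
    have h4 : (diffFactor ω ^ d).map Complex.ofRealHom ∣ p.map Complex.ofRealHom := by
      rw [diffFactor, if_neg hc, Polynomial.map_pow, map_quadr_eq, mul_pow]
      refine IsCoprime.mul_dvd (IsCoprime.pow ?_) h h1
      exact isCoprime_X_sub_C_of_isUnit_sub (IsUnit.mk0 _ (sub_ne_zero.2 (exp_ne_inv hω hc)))
    exact (Polynomial.map_dvd_map' _).1 h4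

theorem exists_eq_X_sub_C_mul_diffFactor {ω : ℝ} (hω : ω ∈ Icc 0 Real.pi) :
    ∃ u : ℂ[X], (diffFactor ω).map Complex.ofRealHom =
      (X - C (Complex.exp (Complex.I * ω))) * u ∧ u.eval (Complex.exp (Complex.I * ω)) ≠ 0 := by
  by_cases hc : ω = 0 ∨ ω = Real.pi
  · have h2 : (Real.cos ω : ℂ) * Real.cos ω = 1 := by rcases hc with rfl | rfl <;> simp
    have h3 : (C (Real.cos ω : ℂ) * C (Real.cos ω : ℂ) : ℂ[X]) = 1 := by rw [← C_mul, h2, C_1]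
    refine ⟨-C (Real.cos ω : ℂ), ?_, ?_⟩
    · rw [diffFactor, if_pos hc, exp_mul_I_eq_cos hc]
      simp only [Polynomial.map_sub, Polynomial.map_mul, Polynomial.map_one, map_X, map_C,
        Complex.ofRealHom_eq_coe]
      linear_combination -h3
    · rw [eval_neg, eval_C, neg_ne_zero]
      exact left_ne_zero_of_mul (h2 ▸ one_ne_zero)
  · refine ⟨_, by rw [diffFactor, if_neg hc, map_quadr_eq], ?_⟩
    rw [eval_sub, eval_X, eval_C]
    exact sub_ne_zero.2 (exp_ne_inv hω hc)

theorem exp_injOn : InjOn (fun ω : ℝ => Complex.exp (Complex.I * ω)) (Icc 0 Real.pi) := by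
  intro a ha b hb h
  refine Real.injOn_cos ha hb ?_
  have := congrArg Complex.re h
  simpa [mul_comm Complex.I, Complex.exp_ofReal_mul_I_re] using this

/-- Each such frequency gives a root `exp (ι ω)` of the nonzero polynomial of a fixed nonzero `x ∈
Lᗮ`. -/
theorem freqSet_finite {n : ℕ} {L : Submodule ℝ (EuclideanSpace ℝ (Fin n))}
    (hL : Module.finrank ℝ L < n) : (freqSet L).Finite := by
  obtain ⟨x, hx, hx0⟩ := exists_orthogonal_ne_zero hL
  refine Set.Finite.of_finite_image (f := fun ω : ℝ => Complex.exp (Complex.I * ω)) ?_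
    (exp_injOn.mono fun ω hω => hω.1)
  refine (((coeffPoly x).map Complex.ofRealHom).roots.toFinset.finite_toSet).subset ?_
  rintro _ ⟨ω, hω, rfl⟩
  simp only [Finset.mem_coe, Multiset.mem_toFinset]
  rw [mem_roots ((Polynomial.map_ne_zero_iff (RingHom.injective _)).2 (coeffPoly_ne_zero hx0))]
  exact dvd_iff_isRoot.1 ((dvd_pow_self _ hω.2.ne').trans (X_sub_C_pow_rho_dvd hx ω))

theorem diffPoly_eq_prod {n : ℕ} {L : Submodule ℝ (EuclideanSpace ℝ (Fin n))}
    (hL : Module.finrank ℝ L < n) :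
    diffPoly L = ∏ ω ∈ (freqSet_finite hL).toFinset, diffFactor ω ^ rho ω L :=
  finprod_mem_eq_finite_toFinset_prod _ _

theorem diffPoly_eval_zero {n : ℕ} {L : Submodule ℝ (EuclideanSpace ℝ (Fin n))}
    (hL : Module.finrank ℝ L < n) : (diffPoly L).eval 0 = 1 := by
  simp [diffPoly_eq_prod hL, eval_prod, diffFactor_eval_zero]

theorem diffPoly_ne_zero {n : ℕ} {L : Submodule ℝ (EuclideanSpace ℝ (Fin n))}
    (hL : Module.finrank ℝ L < n) : diffPoly L ≠ 0 := by
  intro h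
  simpa [h] using diffPoly_eval_zero hL

theorem natDegree_diffPoly {n : ℕ} {L : Submodule ℝ (EuclideanSpace ℝ (Fin n))}
    (hL : Module.finrank ℝ L < n) : (diffPoly L).natDegree = kappaSum L := by
  rw [diffPoly_eq_prod hL, kappaSum, finsum_mem_eq_finite_toFinset_sum _ (freqSet_finite hL),
    natDegree_prod _ _ fun ω _ => pow_ne_zero _ (diffFactor_ne_zero ω)]
  refine Finset.sum_congr rfl fun ω _ => ?_
  rw [natDegree_pow, natDegree_diffFactor, ← kappa_eq_mul]

theorem diffPoly_dvd_coeffPoly {n : ℕ} {L : Submodule ℝ (EuclideanSpace ℝ (Fin n))}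
    (hL : Module.finrank ℝ L < n) {x : EuclideanSpace ℝ (Fin n)} (hx : x ∈ Lᗮ) :
    diffPoly L ∣ coeffPoly x := by
  rw [diffPoly_eq_prod hL]
  refine Finset.prod_dvd_of_coprime (fun a ha b hb hab => ?_) fun ω hω => ?_
  · simp only [Finite.coe_toFinset] at ha hb
    exact (isCoprime_diffFactor fun h => hab (Real.injOn_cos ha.1 hb.1 h)).pow
  · exact diffFactor_pow_dvd ((Finite.mem_toFinset _).1 hω).1 (X_sub_C_pow_rho_dvd hx ω)

/-- The order of `Δ_L` at `exp (ι ω)` is exactly `ρ(ω, L)`. -/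
theorem exists_diffPoly_eq_mul {n : ℕ} {L : Submodule ℝ (EuclideanSpace ℝ (Fin n))}
    (hL : Module.finrank ℝ L < n) {ω : ℝ} (hω : ω ∈ Icc 0 Real.pi) :
    ∃ u : ℂ[X], (diffPoly L).map Complex.ofRealHom =
      (X - C (Complex.exp (Complex.I * ω))) ^ rho ω L * u ∧
        u.eval (Complex.exp (Complex.I * ω)) ≠ 0 := by
  classical
  obtain ⟨v, hv, hv0⟩ := exists_eq_X_sub_C_mul_diffFactor hω
  set F := (freqSet_finite hL).toFinset with hF
  have h1 : diffPoly L = diffFactor ω ^ rho ω L * ∏ ν ∈ F.erase ω, diffFactor ν ^ rho ν L := by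
    rw [diffPoly_eq_prod hL]
    by_cases h : ω ∈ F
    · rw [← Finset.mul_prod_erase F _ h]
    · have h2 : rho ω L = 0 := by
        by_contra h3
        exact h ((Finite.mem_toFinset _).2 ⟨hω, Nat.pos_of_ne_zero h3⟩)
      rw [Finset.erase_eq_of_notMem h, h2, pow_zero, one_mul]
  refine ⟨v ^ rho ω L * (∏ ν ∈ F.erase ω, diffFactor ν ^ rho ν L).map Complex.ofRealHom, ?_, ?_⟩
  · rw [h1, Polynomial.map_mul, Polynomial.map_pow, hv, mul_pow, mul_assoc]
  · rw [eval_mul, eval_pow]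
    refine mul_ne_zero (pow_ne_zero _ hv0) ?_
    rw [Polynomial.map_prod, eval_prod, Finset.prod_ne_zero_iff]
    intro ν hν h2
    rw [Polynomial.map_pow, eval_pow] at h2
    have h3 := cos_eq_of_diffFactor_eval_eq_zero (eq_zero_of_pow_eq_zero h2)
    exact Finset.ne_of_mem_erase hν
      (Real.injOn_cos hω ((Finite.mem_toFinset _).1 (Finset.mem_of_mem_erase hν)).1 h3).symm

/-- Since `Δ_L` vanishes to order exactly `ρ(ω, L)` at `exp (ι ω)`, the value there of the `ρ`-th
Euler iterate of `coeffPoly x` is a nonzero multiple of that of `Q`. -/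
theorem eval_quotient_eq_zero_iff {n : ℕ} {L : Submodule ℝ (EuclideanSpace ℝ (Fin n))}
    (hL : Module.finrank ℝ L < n) {x : EuclideanSpace ℝ (Fin n)} {Q : ℝ[X]}
    (hQ : coeffPoly x = diffPoly L * Q) {ω : ℝ} (hω : ω ∈ Icc 0 Real.pi) :
    (Q.map Complex.ofRealHom).eval (Complex.exp (Complex.I * ω)) = 0 ↔
      ∀ c, inner ℝ x (trigCol n (rho ω L) ω c) = 0 := by
  obtain ⟨u, hu, hu0⟩ := exists_diffPoly_eq_mul hL hω
  rw [← eval_euler_iterate_coeffPoly_eq_zero_iff, hQ, Polynomial.map_mul, hu, mul_assoc,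
    euler_iterate_eval, eval_mul]
  simp [Complex.exp_ne_zero, Nat.factorial_ne_zero, hu0]

theorem natDegree_quotient_le {n : ℕ} {L : Submodule ℝ (EuclideanSpace ℝ (Fin n))}
    (hL : Module.finrank ℝ L < n) {x : EuclideanSpace ℝ (Fin n)} (hx : x ≠ 0) {Q : ℝ[X]}
    (hQ : coeffPoly x = diffPoly L * Q) : Q ≠ 0 ∧ kappaSum L + Q.natDegree ≤ n := by
  have h1 := coeffPoly_ne_zero hx
  have h2 : Q ≠ 0 := fun h => h1 (by rw [hQ, h, mul_zero])
  refine ⟨h2, ?_⟩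
  have h3 := natDegree_coeffPoly_le x
  rwa [hQ, natDegree_mul (diffPoly_ne_zero hL) h2, natDegree_diffPoly hL] at h3

theorem X_dvd_quotient {n : ℕ} {L : Submodule ℝ (EuclideanSpace ℝ (Fin n))}
    (hL : Module.finrank ℝ L < n) {x : EuclideanSpace ℝ (Fin n)} {Q : ℝ[X]}
    (hQ : coeffPoly x = diffPoly L * Q) : X ∣ Q := by
  rw [X_dvd_iff]
  have h := coeff_zero_coeffPoly x
  rw [hQ, coeff_zero_eq_eval_zero, eval_mul, diffPoly_eval_zero hL, one_mul] at h
  rwa [coeff_zero_eq_eval_zero]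

/-- A nonzero quotient vanishing at the frequencies in a finite set `F` has `κ`-weight below
`n - κ(L)`. -/
theorem sum_kappa_add_kappaSum_lt {n : ℕ} {L : Submodule ℝ (EuclideanSpace ℝ (Fin n))}
    (hL : Module.finrank ℝ L < n) {x : EuclideanSpace ℝ (Fin n)} (hx : x ≠ 0) {Q : ℝ[X]}
    (hQ : coeffPoly x = diffPoly L * Q) (F : Finset ℝ) (hF : ↑F ⊆ Icc 0 Real.pi)
    (h0 : ∀ ω ∈ F, (Q.map Complex.ofRealHom).eval (Complex.exp (Complex.I * ω)) = 0) :
    ∑ ω ∈ F, kappa ω 1 + kappaSum L < n := by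
  obtain ⟨hQ0, hdeg⟩ := natDegree_quotient_le hL hx hQ
  have h1 : ∏ ω ∈ F, diffFactor ω ∣ Q := by
    refine Finset.prod_dvd_of_coprime (fun a ha b hb hab =>
      isCoprime_diffFactor fun h => hab (Real.injOn_cos (hF ha) (hF hb) h)) fun ω hω => ?_
    have := diffFactor_pow_dvd (d := 1) (hF hω) (by
      rw [pow_one]; exact dvd_iff_isRoot.2 (h0 ω hω))
    rwa [pow_one] at this
  -- The additional factor `X` contributes one to the degree and turns `≤ n` into `< n`.
  have h2 : X * ∏ ω ∈ F, diffFactor ω ∣ Q :=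
    (IsCoprime.prod_right fun ω _ => isCoprime_X_diffFactor ω).mul_dvd (X_dvd_quotient hL hQ) h1
  have h3 := natDegree_le_of_dvd h2 hQ0
  rw [natDegree_X_mul (Finset.prod_ne_zero_iff.2 fun ω _ => diffFactor_ne_zero ω),
    natDegree_prod _ _ fun ω _ => diffFactor_ne_zero ω] at h3
  simp only [natDegree_diffFactor] at h3
  omega

/-! ### Squared moduli on the circle and the spectral quadratic form. -/

/-- The squared modulus of a real polynomial at `exp (ι ν)`. -/
def polyGain (Q : ℝ[X]) (ν : ℝ) : ℝ :=
  ‖(Q.map Complex.ofRealHom).eval (Complex.exp (Complex.I * ν))‖ ^ 2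

theorem diffGain_eq_polyGain {n : ℕ} (L : Submodule ℝ (EuclideanSpace ℝ (Fin n))) :
    diffGain L = polyGain (diffPoly L) := by
  ext ν
  rw [diffGain, polyGain, aeval_def, eval₂_eq_eval_map]
  rfl

theorem continuous_polyGain (Q : ℝ[X]) : Continuous (polyGain Q) := by
  unfold polyGain
  have h : Continuous fun ν : ℝ => Complex.exp (Complex.I * ν) := by fun_prop
  exact (((Q.map Complex.ofRealHom).continuous.comp h).norm).pow 2

theorem polyGain_nonneg (Q : ℝ[X]) (ν : ℝ) : 0 ≤ polyGain Q ν := sq_nonneg _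

theorem polyGain_mul (P Q : ℝ[X]) (ν : ℝ) : polyGain (P * Q) ν = polyGain P ν * polyGain Q ν := by
  simp [polyGain, mul_pow]

theorem polyGain_neg (Q : ℝ[X]) (ν : ℝ) : polyGain Q (-ν) = polyGain Q ν := by
  have h1 : Complex.exp (Complex.I * ((-ν : ℝ) : ℂ)) =
      starRingEnd ℂ (Complex.exp (Complex.I * ν)) := by
    rw [conj_exp, ← Complex.exp_neg]
    simp
  have h2 : (Q.map Complex.ofRealHom).eval (starRingEnd ℂ (Complex.exp (Complex.I * ν))) =
      starRingEnd ℂ ((Q.map Complex.ofRealHom).eval (Complex.exp (Complex.I * ν))) := by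
    rw [eval_map, eval_map, hom_eval₂]
    congr 1
    ext x
    simp
  rw [polyGain, h1, h2, RCLike.norm_conj, polyGain]

theorem exists_polyGain_le (Q : ℝ[X]) : ∃ C, ∀ ν, polyGain Q ν ≤ C := by
  obtain ⟨C, hC⟩ := (isCompact_sphere (0 : ℂ) 1).exists_bound_of_continuousOn
    (f := fun z => (Q.map Complex.ofRealHom).eval z)
    (Q.map Complex.ofRealHom).continuous.continuousOn
  refine ⟨C ^ 2, fun ν => ?_⟩
  refine pow_le_pow_left₀ (norm_nonneg _) (hC _ ?_) 2
  rw [mem_sphere_zero_iff_norm, mul_comm, Complex.norm_exp_ofReal_mul_I]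

/-- `polyGain` as a bounded continuous function. -/
def polyGainBCF (Q : ℝ[X]) : BoundedContinuousFunction ℝ ℝ :=
  BoundedContinuousFunction.ofNormedAddCommGroup (polyGain Q) (continuous_polyGain Q)
    (exists_polyGain_le Q).choose fun ν => by
      rw [Real.norm_of_nonneg (polyGain_nonneg Q ν)]
      exact (exists_polyGain_le Q).choose_spec ν

theorem polyGain_eq_zero_iff (Q : ℝ[X]) (ν : ℝ) : polyGain Q ν = 0 ↔
    (Q.map Complex.ofRealHom).eval (Complex.exp (Complex.I * ν)) = 0 := by
  simp [polyGain]

theorem finite_polyGain_eq_zero {Q : ℝ[X]} (hQ : Q ≠ 0) :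
    {ν | ν ∈ Icc (-Real.pi) Real.pi ∧ polyGain Q ν = 0}.Finite := by
  have h1 : {ν | ν ∈ Icc 0 Real.pi ∧ polyGain Q ν = 0}.Finite := by
    refine Set.Finite.of_finite_image (f := fun ω : ℝ => Complex.exp (Complex.I * ω)) ?_
      (exp_injOn.mono fun ω hω => hω.1)
    refine ((Q.map Complex.ofRealHom).roots.toFinset.finite_toSet).subset ?_
    rintro _ ⟨ω, hω, rfl⟩
    simp only [Finset.mem_coe, Multiset.mem_toFinset]
    rw [mem_roots ((Polynomial.map_ne_zero_iff (RingHom.injective _)).2 hQ)]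
    exact (polyGain_eq_zero_iff _ _).1 hω.2
  refine (h1.union (h1.image fun ν => -ν)).subset fun ν hν => ?_
  rcases le_total 0 ν with h | h
  · exact Or.inl ⟨⟨h, hν.1.2⟩, hν.2⟩
  · refine Or.inr ⟨-ν, ⟨⟨by linarith, by linarith [hν.1.1]⟩, ?_⟩, neg_neg ν⟩
    rw [polyGain_neg]
    exact hν.2

theorem intervalIntegrable_mul_of_continuous {f g : ℝ → ℝ} (hg : Continuous g)
    (hf : f ∈ normalizedSpectralDensities) :
    IntervalIntegrable (fun ω => g ω * f ω) volume (-Real.pi) Real.pi := by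
  have h := hf.2.2.1
  have h1 : IntervalIntegrable f volume (-Real.pi) Real.pi := by
    rw [intervalIntegrable_iff_integrableOn_Icc_of_le (by linarith [Real.pi_pos])]
    exact h
  exact h1.continuousOn_mul hg.continuousOn

theorem spectralMatrix_apply {n : ℕ} {f : ℝ → ℝ} (hf : f ∈ normalizedSpectralDensities)
    (j l : Fin n) : spectralMatrix n f j l =
      ∫ ω in (-Real.pi)..Real.pi, Real.cos ((((j : ℕ) : ℝ) - ((l : ℕ) : ℝ)) * ω) * f ω := by
  have hi : IntervalIntegrable f volume (-Real.pi) Real.pi := by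
    simpa using intervalIntegrable_mul_of_continuous continuous_const (g := fun _ => 1) hf
  have h1 : IntervalIntegrable (fun ω : ℝ =>
      Complex.exp (-(Complex.I * (((j : ℕ) : ℂ) - ((l : ℕ) : ℂ)) * (ω : ℂ))) * (f ω : ℂ))
      volume (-Real.pi) Real.pi := by
    refine IntervalIntegrable.continuousOn_mul ?_ (by fun_prop)
    exact ⟨hi.1.ofReal, hi.2.ofReal⟩
  rw [spectralMatrix, Matrix.of_apply, ← Complex.reCLM_apply,
    ← ContinuousLinearMap.intervalIntegral_comp_comm _ h1]
  refine intervalIntegral.integral_congr fun ω _ => ?_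
  have h2 : Complex.exp (-(Complex.I * (((j : ℕ) : ℂ) - ((l : ℕ) : ℂ)) * (ω : ℂ))) =
      Complex.exp (((-((((j : ℕ) : ℝ) - ((l : ℕ) : ℝ)) * ω) : ℝ) : ℂ) * Complex.I) := by
    congr 1
    push_cast
    ring
  simp only [Complex.reCLM_apply, Complex.re_mul_ofReal, h2, Complex.exp_ofReal_mul_I_re,
    Real.cos_neg]

theorem polyGain_coeffPoly {n : ℕ} (x : EuclideanSpace ℝ (Fin n)) (ω : ℝ) :
    polyGain (coeffPoly x) ω =
      ∑ j, ∑ l, x j * x l * Real.cos ((((j : Fin n) : ℕ) - ((l : Fin n) : ℕ) : ℝ) * ω) := by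
  have h := eval_euler_iterate_coeffPoly x 0 ω
  rw [Function.iterate_zero, id_eq] at h
  rw [polyGain, h, ← Complex.normSq_eq_norm_sq, Complex.normSq_add_mul_I, pow_two, pow_two]
  simp only [PiLp.inner_apply, trigCol, trigMatrix, Matrix.of_apply, Finset.sum_mul_sum,
    ← Finset.sum_add_distrib]
  refine Finset.sum_congr rfl fun j _ => Finset.sum_congr rfl fun l _ => ?_
  have h1 : ((j : ℕ) - (l : ℕ) : ℝ) * ω = ((j : ℕ) + 1 : ℝ) * ω - ((l : ℕ) + 1 : ℝ) * ω := by ring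
  rw [h1, Real.cos_sub]
  simp
  ring

theorem dotProduct_spectralMatrix_mulVec {n : ℕ} {f : ℝ → ℝ}
    (hf : f ∈ normalizedSpectralDensities) (x : EuclideanSpace ℝ (Fin n)) :
    x.ofLp ⬝ᵥ (spectralMatrix n f).mulVec x.ofLp =
      ∫ ω in (-Real.pi)..Real.pi, polyGain (coeffPoly x) ω * f ω := by
  simp only [polyGain_coeffPoly, Finset.sum_mul]
  have hi : ∀ j l : Fin n, IntervalIntegrable (fun ω : ℝ =>
      x j * x l * Real.cos (((j : ℕ) - (l : ℕ) : ℝ) * ω) * f ω) volume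
      (-Real.pi) Real.pi := fun j l => intervalIntegrable_mul_of_continuous
        (g := fun ω => x j * x l * Real.cos (((j : ℕ) - (l : ℕ) : ℝ) * ω)) (by fun_prop) hf
  rw [intervalIntegral.integral_finsetSum fun j _ => by
    have h := IntervalIntegrable.sum Finset.univ fun l _ => hi j l
    rwa [Finset.sum_fn] at h]
  simp only [dotProduct, Matrix.mulVec, Finset.mul_sum]
  refine Finset.sum_congr rfl fun j _ => ?_
  rw [intervalIntegral.integral_finsetSum fun l _ => hi j l]
  refine Finset.sum_congr rfl fun l _ => ?_
  rw [spectralMatrix_apply hf]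
  simp only [mul_assoc, intervalIntegral.integral_const_mul]
  ring

theorem integral_polyGain_mul_nonneg {f : ℝ → ℝ} (hf : f ∈ normalizedSpectralDensities)
    (Q : ℝ[X]) : 0 ≤ ∫ ω in (-Real.pi)..Real.pi, polyGain Q ω * f ω :=
  intervalIntegral.integral_nonneg (by linarith [Real.pi_pos]) fun ω hω =>
    mul_nonneg (polyGain_nonneg _ _) (hf.1 ω hω)

theorem posSemidef_spectralMatrix {n : ℕ} {f : ℝ → ℝ}
    (hf : f ∈ normalizedSpectralDensities) : (spectralMatrix n f).PosSemidef := by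
  refine Matrix.PosSemidef.of_dotProduct_mulVec_nonneg ?_ fun x => ?_
  · ext j l
    rw [Matrix.conjTranspose_apply, star_trivial, spectralMatrix_apply hf, spectralMatrix_apply hf]
    refine intervalIntegral.integral_congr fun ω _ => ?_
    rw [← Real.cos_neg]
    congr 2
    ring
  · rw [star_trivial]
    exact (dotProduct_spectralMatrix_mulVec hf (WithLp.toLp 2 x)).symm ▸
      integral_polyGain_mul_nonneg hf _

/-- `|Q|²` has only finitely many zeros in `[-π, π]`, so a vanishing integral would make `f` zero
almost everywhere, against its total mass one. -/
theorem integral_polyGain_mul_pos {f : ℝ → ℝ} (hf : f ∈ normalizedSpectralDensities)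
    {Q : ℝ[X]} (hQ : Q ≠ 0) : 0 < ∫ ω in (-Real.pi)..Real.pi, polyGain Q ω * f ω := by
  have hpi : -Real.pi ≤ Real.pi := by linarith [Real.pi_pos]
  refine lt_of_le_of_ne (integral_polyGain_mul_nonneg hf Q) fun h => ?_
  have h1 : 0 ≤ᵐ[volume.restrict (Icc (-Real.pi) Real.pi)] fun ω => polyGain Q ω * f ω := by
    filter_upwards [ae_restrict_mem measurableSet_Icc] with ω hω
    exact mul_nonneg (polyGain_nonneg _ _) (hf.1 ω hω)
  have h2 := (intervalIntegrable_iff_integrableOn_Icc_of_le hpi).1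
    (intervalIntegrable_mul_of_continuous (continuous_polyGain Q) hf)
  rw [intervalIntegral.integral_of_le hpi, ← integral_Icc_eq_integral_Ioc, eq_comm,
    integral_eq_zero_iff_of_nonneg_ae h1 h2] at h
  have h3 : f =ᵐ[volume.restrict (Icc (-Real.pi) Real.pi)] 0 := by
    have h4 : ∀ᵐ ω ∂volume.restrict (Icc (-Real.pi) Real.pi),
        ω ∉ {ν | ν ∈ Icc (-Real.pi) Real.pi ∧ polyGain Q ν = 0} :=
      measure_eq_zero_iff_ae_notMem.1 ((finite_polyGain_eq_zero hQ).measure_zero _)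
    filter_upwards [h, h4, ae_restrict_mem measurableSet_Icc] with ω h5 h6 h7
    exact (mul_eq_zero.1 h5).resolve_left fun h8 => h6 ⟨h7, h8⟩
  have h9 := hf.2.2.2
  rw [intervalIntegral.integral_of_le hpi, ← integral_Icc_eq_integral_Ioc,
    integral_congr_ae h3] at h9
  simp at h9

/-! ### Filtered densities as symmetric probability measures. -/

section Density

variable {n : ℕ} {L : Submodule ℝ (EuclideanSpace ℝ (Fin n))} {f : ℝ → ℝ}

theorem filteredDensity_nonneg (hf : f ∈ normalizedSpectralDensities) {ν : ℝ}
    (hν : ν ∈ Icc (-Real.pi) Real.pi) : 0 ≤ filteredDensity L f ν := by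
  unfold filteredDensity
  rw [diffGain_eq_polyGain]
  exact div_nonneg (mul_nonneg (polyGain_nonneg _ _) (hf.1 ν hν))
    (integral_polyGain_mul_nonneg hf _)

theorem integrableOn_filteredDensity (hf : f ∈ normalizedSpectralDensities) :
    IntegrableOn (filteredDensity L f) (Icc (-Real.pi) Real.pi) := by
  rw [← intervalIntegrable_iff_integrableOn_Icc_of_le (by linarith [Real.pi_pos])]
  unfold filteredDensity
  rw [diffGain_eq_polyGain]
  exact (intervalIntegrable_mul_of_continuous (continuous_polyGain _) hf).div_const _

/-- The filter absorbs the factor `|Δ_L|²`. For `Q = Q_x` the numerator is the quadratic form of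
`Σ(f)` at `x`. -/
theorem integral_polyGain_densityMeasure (hf : f ∈ normalizedSpectralDensities) (Q : ℝ[X]) :
    ∫ ν, polyGain Q ν ∂densityMeasure (filteredDensity L f) =
      (∫ ν in (-Real.pi)..Real.pi, polyGain (diffPoly L * Q) ν * f ν) /
        ∫ ν in (-Real.pi)..Real.pi, polyGain (diffPoly L) ν * f ν := by
  have hpi : -Real.pi ≤ Real.pi := by linarith [Real.pi_pos]
  rw [densityMeasure, integral_withDensity_eq_integral_toReal_smul₀
    (integrableOn_filteredDensity hf).aemeasurable.ennreal_ofReal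
    (Eventually.of_forall fun _ => ENNReal.ofReal_lt_top),
    ← intervalIntegral.integral_div, intervalIntegral.integral_of_le hpi,
    ← integral_Icc_eq_integral_Ioc]
  refine setIntegral_congr_fun measurableSet_Icc fun ν hν => ?_
  rw [ENNReal.toReal_ofReal (filteredDensity_nonneg hf hν)]
  simp only [polyGain_mul, smul_eq_mul, filteredDensity, diffGain_eq_polyGain]
  ring

theorem densityMeasure_compl_Icc (g : ℝ → ℝ) :
    densityMeasure g (Icc (-Real.pi) Real.pi)ᶜ = 0 := by
  refine withDensity_absolutelyContinuous _ _ ?_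
  rw [Measure.restrict_apply measurableSet_Icc.compl]
  simp

theorem isProbabilityMeasure_densityMeasure (hL : Module.finrank ℝ L < n)
    (hf : f ∈ normalizedSpectralDensities) :
    IsProbabilityMeasure (densityMeasure (filteredDensity L f)) := by
  have : IsFiniteMeasure (densityMeasure (filteredDensity L f)) :=
    isFiniteMeasure_withDensity_ofReal (integrableOn_filteredDensity hf).2
  rw [isProbabilityMeasure_iff_real]
  have h := integral_polyGain_densityMeasure (L := L) hf 1
  have h1 : polyGain 1 = fun _ => 1 := by ext; simp [polyGain]
  rw [mul_one, div_self (integral_polyGain_mul_pos hf (diffPoly_ne_zero hL)).ne', h1] at h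
  simpa using h

theorem map_neg_densityMeasure (hf : f ∈ normalizedSpectralDensities) :
    (densityMeasure (filteredDensity L f)).map (fun ν => -ν) =
      densityMeasure (filteredDensity L f) := by
  ext s hs
  have hn : MeasurableSet ((fun ν : ℝ => -ν) ⁻¹' s) := measurable_neg hs
  rw [Measure.map_apply measurable_neg hs, densityMeasure, withDensity_apply _ hn,
    withDensity_apply _ hs, Measure.restrict_restrict hn, Measure.restrict_restrict hs]
  have hmp : MeasurePreserving (fun ν : ℝ => -ν) volume volume :=
    Measure.measurePreserving_neg volume
  have hset : (fun ν : ℝ => -ν) ⁻¹' s ∩ Icc (-Real.pi) Real.pi =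
      (fun ν : ℝ => -ν) ⁻¹' (s ∩ Icc (-Real.pi) Real.pi) := by
    ext ν
    simp only [mem_inter_iff, mem_preimage, mem_Icc]
    constructor <;> rintro ⟨h1, h2, h3⟩ <;> exact ⟨h1, by linarith, by linarith⟩
  rw [hset]
  refine Eq.trans ?_ (hmp.setLIntegral_comp_preimage_emb
    (MeasurableEquiv.neg ℝ).measurableEmbedding _ _)
  refine setLIntegral_congr_fun (measurable_neg (hs.inter measurableSet_Icc)) fun ν hν => ?_
  have h1 : f (-ν) = f ν := by
    have := hf.2.1 (-ν) hν.2
    rw [← this, neg_neg]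
  simp only [filteredDensity, diffGain_eq_polyGain, polyGain_neg, h1]

end Density

/-! ### Weak limits and their supports. -/

/-- All the measures are probabilities carried by the compact interval `[-π, π]`, so they are tight
and Prokhorov's theorem applies. -/
theorem exists_limit_measure {n : ℕ} {L : Submodule ℝ (EuclideanSpace ℝ (Fin n))}
    (hL : Module.finrank ℝ L < n) {f : ℕ → ℝ → ℝ} (hf : ∀ j, f j ∈ normalizedSpectralDensities) :
    ∃ (φ : ℕ → ℕ) (m : FiniteMeasure ℝ) (mg : ℕ → FiniteMeasure ℝ), StrictMono φ ∧
      (∀ j, (mg j : Measure ℝ) = densityMeasure (filteredDensity L (f (φ j)))) ∧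
      Tendsto mg atTop (𝓝 m) := by
  have := fun j => isProbabilityMeasure_densityMeasure hL (hf j)
  let P : ℕ → ProbabilityMeasure ℝ := fun j => ⟨densityMeasure (filteredDensity L (f j)), this j⟩
  have hK := isCompact_setOfPred_probabilityMeasure_mass_eq_compl_isCompact_le (E := ℝ)
    (u := fun _ => 0) (K := fun _ => Icc (-Real.pi) Real.pi) tendsto_const_nhds
    (fun _ => isCompact_Icc) (Or.inl inferInstance)
  obtain ⟨m, -, φ, hφ, hlim⟩ := hK.tendsto_subseq (x := P) fun j _ => by
    refine le_of_eq ?_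
    rw [← ENNReal.coe_inj, ProbabilityMeasure.ennreal_coeFn_eq_coeFn_toMeasure]
    exact densityMeasure_compl_Icc _
  exact ⟨φ, m.toFiniteMeasure, fun j => (P (φ j)).toFiniteMeasure, hφ, fun j => rfl,
    ProbabilityMeasure.tendsto_nhds_iff_toFiniteMeasure_tendsto_nhds _ |>.1 hlim⟩

section Limit

variable {n : ℕ} {L : Submodule ℝ (EuclideanSpace ℝ (Fin n))} {f : ℕ → ℝ → ℝ}
  {m : FiniteMeasure ℝ} {mg : ℕ → FiniteMeasure ℝ}

theorem limit_compl_Icc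
    (hmg : ∀ j, (mg j : Measure ℝ) = densityMeasure (filteredDensity L (f j)))
    (hlim : Tendsto mg atTop (𝓝 m)) : (m : Measure ℝ) (Icc (-Real.pi) Real.pi)ᶜ = 0 := by
  -- A bounded continuous nonnegative function with zero set exactly `[-π, π]`: its integral is zero
  -- along the sequence, hence also in the limit.
  set g : BoundedContinuousFunction ℝ ℝ := BoundedContinuousFunction.ofNormedAddCommGroup
    (fun ν => min 1 (Metric.infDist ν (Icc (-Real.pi) Real.pi)))
    (continuous_const.min (Metric.continuous_infDist_pt _)) 1 (fun ν => by
      rw [Real.norm_of_nonneg (le_min zero_le_one Metric.infDist_nonneg)]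
      exact min_le_left _ _) with hg
  have hne : (Icc (-Real.pi) Real.pi).Nonempty := ⟨0, by constructor <;> linarith [Real.pi_pos]⟩
  have hg0 : ∀ ν, 0 ≤ g ν := fun ν => le_min zero_le_one Metric.infDist_nonneg
  have hgz : ∀ ν, g ν = 0 ↔ ν ∈ Icc (-Real.pi) Real.pi := by
    intro ν
    have h1 : ν ∈ Icc (-Real.pi) Real.pi ↔ Metric.infDist ν (Icc (-Real.pi) Real.pi) = 0 :=
      isClosed_Icc.mem_iff_infDist_zero hne
    rw [h1]
    change min 1 _ = 0 ↔ _
    constructor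
    · intro h
      rcases min_choice 1 (Metric.infDist ν (Icc (-Real.pi) Real.pi)) with h2 | h2
      · rw [h2] at h; exact absurd h one_ne_zero
      · rw [← h2, h]
    · intro h; rw [h]; simp
  have h := FiniteMeasure.tendsto_iff_forall_integral_tendsto.1 hlim g
  have h0 : ∀ j, ∫ ν, g ν ∂(mg j : Measure ℝ) = 0 := by
    intro j
    refine integral_eq_zero_of_ae ?_
    have h1 := densityMeasure_compl_Icc (filteredDensity L (f j))
    rw [← hmg] at h1
    filter_upwards [measure_eq_zero_iff_ae_notMem.1 h1] with ν hν
    exact (hgz ν).2 (not_not.1 hν)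
  simp only [h0] at h
  have h1 := (tendsto_nhds_unique h tendsto_const_nhds)
  rw [integral_eq_zero_iff_of_nonneg hg0 (g.integrable _)] at h1
  rw [measure_eq_zero_iff_ae_notMem]
  filter_upwards [h1] with ν hν
  exact not_not.2 ((hgz ν).1 hν)

theorem limit_map_neg (hf : ∀ j, f j ∈ normalizedSpectralDensities)
    (hmg : ∀ j, (mg j : Measure ℝ) = densityMeasure (filteredDensity L (f j)))
    (hlim : Tendsto mg atTop (𝓝 m)) : (m : Measure ℝ).map (fun ν => -ν) = (m : Measure ℝ) := by
  have h1 := ((FiniteMeasure.continuous_map (continuous_neg (G := ℝ))).tendsto m).comp hlim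
  have h2 : ((fun ν : FiniteMeasure ℝ => ν.map (fun x => -x)) ∘ mg) = mg := by
    funext j
    apply FiniteMeasure.toMeasure_injective
    change (mg j : Measure ℝ).map (fun ν => -ν) = _
    rw [hmg]
    exact map_neg_densityMeasure (hf j)
  rw [h2] at h1
  exact congrArg FiniteMeasure.toMeasure (tendsto_nhds_unique h1 hlim)

theorem limit_ne_zero (hL : Module.finrank ℝ L < n)
    (hf : ∀ j, f j ∈ normalizedSpectralDensities)
    (hmg : ∀ j, (mg j : Measure ℝ) = densityMeasure (filteredDensity L (f j)))
    (hlim : Tendsto mg atTop (𝓝 m)) : (m : Measure ℝ) ≠ 0 := by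
  have h1 : ∀ j, (mg j).mass = 1 := by
    intro j
    have := isProbabilityMeasure_densityMeasure hL (hf j)
    rw [← ENNReal.coe_inj, FiniteMeasure.ennreal_mass, hmg, measure_univ, ENNReal.coe_one]
  have h2 := hlim.mass
  simp only [h1] at h2
  have h3 : m.mass = 1 := tendsto_nhds_unique h2 tendsto_const_nhds
  intro h
  have h4 := FiniteMeasure.ennreal_mass (μ := m)
  rw [h3, h] at h4
  simp at h4

end Limit

theorem neg_mem_support {m : Measure ℝ} (h : m.map (fun ν => -ν) = m) {ν : ℝ}
    (hν : ν ∈ m.support) : -ν ∈ m.support := by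
  rw [Measure.mem_support_iff_forall] at hν ⊢
  intro U hU
  obtain ⟨V, hVU, hVo, hV⟩ := mem_nhds_iff.1 hU
  have h2 := hν ((fun ν => -ν) ⁻¹' V)
    (continuous_neg.continuousAt.preimage_mem_nhds (hVo.mem_nhds hV))
  rw [← Measure.map_apply measurable_neg hVo.measurableSet, h] at h2
  exact h2.trans_le (measure_mono hVU)

theorem support_subset_Icc {m : Measure ℝ} (h : m (Icc (-Real.pi) Real.pi)ᶜ = 0) :
    m.support ⊆ Icc (-Real.pi) Real.pi :=
  Measure.support_subset_of_isClosed isClosed_Icc (by rwa [mem_ae_iff])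

theorem nonempty_support_inter_Icc {m : Measure ℝ} (h0 : m ≠ 0)
    (h : m (Icc (-Real.pi) Real.pi)ᶜ = 0) (hn : m.map (fun ν => -ν) = m) :
    (m.support ∩ Icc 0 Real.pi).Nonempty := by
  obtain ⟨ν, hν⟩ := Measure.nonempty_support h0
  have h1 := support_subset_Icc h hν
  rcases le_total 0 ν with h2 | h2
  · exact ⟨ν, hν, h2, h1.2⟩
  · exact ⟨-ν, neg_mem_support hn hν, by linarith, by linarith [h1.1]⟩

/-- The integral of `|Q|²` against a symmetric measure vanishes iff `Q` vanishes on the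
nonnegative part of the support. -/
theorem integral_polyGain_eq_zero_iff {m : FiniteMeasure ℝ}
    (h : (m : Measure ℝ) (Icc (-Real.pi) Real.pi)ᶜ = 0)
    (hn : (m : Measure ℝ).map (fun ν => -ν) = m) (Q : ℝ[X]) :
    ∫ ν, polyGain Q ν ∂(m : Measure ℝ) = 0 ↔
      ∀ ν ∈ (m : Measure ℝ).support ∩ Icc 0 Real.pi, polyGain Q ν = 0 := by
  have hi : Integrable (polyGain Q) (m : Measure ℝ) := (polyGainBCF Q).integrable _
  rw [integral_eq_zero_iff_of_nonneg (polyGain_nonneg Q) hi]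
  constructor
  · intro h1 ν hν
    have h2 : (m : Measure ℝ).support ⊆ {ν | polyGain Q ν = 0} :=
      Measure.support_subset_of_isClosed
        (isClosed_eq (continuous_polyGain Q) continuous_const) h1
    exact h2 hν.1
  · intro h1
    filter_upwards [Measure.support_mem_ae (μ := (m : Measure ℝ))] with ν hν
    have h2 := support_subset_Icc h hν
    rcases le_total 0 ν with h3 | h3
    · exact h1 ν ⟨hν, h3, h2.2⟩
    · rw [← polyGain_neg]
      exact h1 (-ν) ⟨neg_mem_support hn hν, by linarith, by linarith [h2.1]⟩

/-! ### Limits of the rescaled covariance square roots. -/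

section Maps

variable {n : ℕ} {L : Submodule ℝ (EuclideanSpace ℝ (Fin n))}

theorem mem_orthogonal_projSpan_iff {Γ : Set ℝ} (x : EuclideanSpace ℝ (Fin n)) :
    x ∈ (projSpan L Γ)ᗮ ↔
      ∀ γ ∈ Γ, ∀ c, inner ℝ (Lᗮ.starProjection x) (trigCol n (rho γ L) γ c) = 0 := by
  rw [projSpan, Submodule.mem_orthogonal]
  constructor
  · intro h γ hγ c
    rw [Submodule.inner_starProjection_left_eq_right, real_inner_comm]
    exact h _ (Submodule.subset_span ⟨γ, hγ, c, rfl⟩)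
  · intro h u hu
    induction hu using Submodule.span_induction with
    | mem u hu =>
      obtain ⟨γ, hγ, c, rfl⟩ := hu
      rw [Submodule.inner_starProjection_left_eq_right, real_inner_comm]
      exact h γ hγ c
    | zero => simp
    | add u v _ _ hu hv => rw [inner_add_left, hu, hv, add_zero]
    | smul a u _ hu => rw [inner_smul_left, hu, mul_zero]

theorem projSpan_le_orthogonal (Γ : Set ℝ) : projSpan L Γ ≤ Lᗮ := by
  rw [projSpan, Submodule.span_le]
  rintro _ ⟨γ, -, c, rfl⟩
  exact Submodule.starProjection_apply_mem _ _

theorem projSpan_mono {Γ Γ' : Set ℝ} (h : Γ ⊆ Γ') : projSpan L Γ ≤ projSpan L Γ' :=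
  Submodule.span_mono fun _ ⟨γ, hγ, c, hv⟩ => ⟨γ, h hγ, c, hv⟩

theorem limitSupports_nonempty (hL : Module.finrank ℝ L < n) {𝔉 : Set (ℝ → ℝ)}
    (h𝔉 : 𝔉 ⊆ normalizedSpectralDensities) {Γ : Set ℝ} (hΓ : Γ ∈ limitSupports 𝔉 L) :
    Γ.Nonempty := by
  obtain ⟨m, ⟨h1, h2, -, ⟨f, hf, mg, hmg, hlim⟩, -⟩, rfl⟩ := hΓ
  exact nonempty_support_inter_Icc (limit_ne_zero hL (fun j => h𝔉 (hf j)) hmg hlim) h1 h2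

/-- Along a subsequence, suitably rescaled projected square roots of the spectral matrices converge,
and the range of the limit is either all of `L^⊥` or one of the relevant subspaces. -/
theorem exists_limit_map (hL : Module.finrank ℝ L < n) {𝔉 : Set (ℝ → ℝ)}
    (h𝔉 : 𝔉 ⊆ normalizedSpectralDensities) {f : ℕ → ℝ → ℝ} (hf : ∀ j, f j ∈ 𝔉)
    (σ : ℕ → ℝ) (hσ : ∀ j, 0 < σ j)
    (M : ℕ → EuclideanSpace ℝ (Fin n) →L[ℝ] EuclideanSpace ℝ (Fin n))
    (hMsa : ∀ j, IsSelfAdjoint (M j))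
    (hM : ∀ j x, ‖M j x‖ ^ 2 = σ j ^ 2 * (x.ofLp ⬝ᵥ (spectralMatrix n (f j)).mulVec x.ofLp)) :
    ∃ (φ : ℕ → ℕ) (t : ℕ → ℝ) (D : EuclideanSpace ℝ (Fin n) →L[ℝ] EuclideanSpace ℝ (Fin n)),
      StrictMono φ ∧ (∀ j, t j ≠ 0) ∧
      Tendsto (fun j => t j • (Lᗮ.starProjection ∘L M (φ j))) atTop (𝓝 D) ∧
      (D.toLinearMap.range = Lᗮ ∨ D.toLinearMap.range ∈ relevantSubspaces 𝔉 L) := by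
  have hf' := fun j => h𝔉 (hf j)
  obtain ⟨φ, m, mg, hφ, hmg, hlim⟩ := exists_limit_measure hL hf'
  have hIcc := limit_compl_Icc hmg hlim
  have hneg := limit_map_neg (fun j => hf' (φ j)) hmg hlim
  have hq : ∀ x, ∃ Q, coeffPoly (Lᗮ.starProjection x) = diffPoly L * Q := fun x =>
    diffPoly_dvd_coeffPoly hL (Submodule.starProjection_apply_mem _ _)
  choose q hq using hq
  set c : ℕ → ℝ := fun j => ∫ ν in (-Real.pi)..Real.pi, polyGain (diffPoly L) ν * f j ν with hc
  have hcpos : ∀ j, 0 < c j := fun j => integral_polyGain_mul_pos (hf' j) (diffPoly_ne_zero hL)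
  -- `c j` is the normalizing constant of the filtered density, so this scaling cancels `σ j` and
  -- makes the squared norms equal to integrals of `|q x|²` against the filtered measures.
  set t : ℕ → ℝ := fun j => (σ j * √(c j))⁻¹ with ht
  have htpos : ∀ j, 0 < t j := fun j =>
    inv_pos.2 (mul_pos (hσ j) (Real.sqrt_pos.2 (hcpos j)))
  have hA : ∀ x, Tendsto (fun j => ‖(t (φ j) • (M (φ j) ∘L Lᗮ.starProjection)) x‖ ^ 2) atTop
      (𝓝 (∫ ν, polyGain (q x) ν ∂(m : Measure ℝ))) := by
    intro x
    refine (FiniteMeasure.tendsto_iff_forall_integral_tendsto.1 hlim (polyGainBCF (q x))).congr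
      fun j => ?_
    change ∫ ν, polyGain (q x) ν ∂(mg j : Measure ℝ) = _
    rw [hmg, integral_polyGain_densityMeasure (hf' _), ← hq,
      ← dotProduct_spectralMatrix_mulVec (hf' _)]
    change _ / c (φ j) = ‖t (φ j) • M (φ j) (Lᗮ.starProjection x)‖ ^ 2
    rw [norm_smul, mul_pow, hM, Real.norm_of_nonneg (htpos _).le, ht]
    have h1 := Real.sq_sqrt (hcpos (φ j)).le
    have h2 := (hσ (φ j)).ne'
    have h3 := (hcpos (φ j)).ne'
    simp only [inv_pow, mul_pow, h1]
    field_simp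
  obtain ⟨ψ, A₀, hψ, hA₀, hA₀n⟩ := exists_tendsto_subseq_of_norm_apply_tendsto
    (fun j => t (φ j) • (M (φ j) ∘L Lᗮ.starProjection)) _ hA
  set Γ : Set ℝ := (m : Measure ℝ).support ∩ Icc 0 Real.pi with hΓ
  have hker : A₀.toLinearMap.ker = (projSpan L Γ)ᗮ := by
    ext x
    rw [LinearMap.mem_ker, mem_orthogonal_projSpan_iff]
    change A₀ x = 0 ↔ _
    rw [← norm_eq_zero, ← sq_eq_zero_iff, hA₀n, integral_polyGain_eq_zero_iff hIcc hneg]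
    refine forall₂_congr fun γ hγ => ?_
    rw [polyGain_eq_zero_iff, eval_quotient_eq_zero_iff hL (hq x) hγ.2]
  -- The norms control `M ∘ Π`, whereas the Gaussian vector involves `Π ∘ M`, its adjoint; the range
  -- of the limiting adjoint is the orthogonal complement of the kernel of `A₀`.
  have hrange : (ContinuousLinearMap.adjoint A₀).toLinearMap.range = projSpan L Γ := by
    have h1 := ContinuousLinearMap.orthogonal_ker A₀
    rw [hker, Submodule.orthogonal_orthogonal] at h1
    rw [h1, Submodule.topologicalClosure_eq_self]
  refine ⟨φ ∘ ψ, fun j => t (φ (ψ j)), ContinuousLinearMap.adjoint A₀, hφ.comp hψ,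
    fun j => (htpos _).ne', ?_, ?_⟩
  · have h1 := ((ContinuousLinearMap.adjoint (𝕜 := ℝ) (E := EuclideanSpace ℝ (Fin n))
      (F := EuclideanSpace ℝ (Fin n))).continuous.tendsto A₀).comp hA₀
    refine h1.congr fun j => ?_
    simp only [Function.comp_apply, map_smulₛₗ, ContinuousLinearMap.adjoint_comp,
      (hMsa _).adjoint_eq, (isSelfAdjoint_starProjection Lᗮ).adjoint_eq]
    rfl
  · rw [hrange]
    by_cases hS : projSpan L Γ = Lᗮ
    · exact Or.inl hS
    right
    have hlt : projSpan L Γ < Lᗮ := lt_of_le_of_ne (projSpan_le_orthogonal Γ) hS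
    have hdim := Submodule.finrank_lt_finrank_of_lt hlt
    have hsum := Submodule.finrank_add_finrank_orthogonal L
    rw [finrank_euclideanSpace_fin] at hsum
    refine ⟨by omega, Γ, ⟨m, ⟨hIcc, hneg, ?_⟩, rfl⟩, rfl⟩
    -- A proper inclusion in `Lᗮ` leaves a nonzero `x ∈ Lᗮ` with `q x` vanishing on all of `Γ`; this
    -- single polynomial gives both finiteness of the support and the weight bound.
    obtain ⟨x, hxS, hxL, hx0⟩ : ∃ x ∈ (projSpan L Γ)ᗮ, x ∈ Lᗮ ∧ x ≠ 0 := by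
      by_contra! hcon
      refine hlt.not_ge fun y hy => ?_
      rw [← Submodule.orthogonal_orthogonal (projSpan L Γ)]
      have h1 : (projSpan L Γ).starProjection y ∈ Lᗮ :=
        projSpan_le_orthogonal Γ (Submodule.starProjection_apply_mem _ _)
      have h2 := hcon _ (Submodule.sub_starProjection_mem_orthogonal (K := projSpan L Γ) y)
        (sub_mem hy h1)
      rw [Submodule.orthogonal_orthogonal, sub_eq_zero.1 h2]
      exact Submodule.starProjection_apply_mem _ _
    have hproj : Lᗮ.starProjection x = x := Submodule.starProjection_eq_self_iff.2 hxL
    have hqx : coeffPoly x = diffPoly L * q x := by rw [← hq, hproj]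
    have hz : ∀ γ ∈ Γ, ((q x).map Complex.ofRealHom).eval (Complex.exp (Complex.I * γ)) = 0 := by
      intro γ hγ
      rw [eval_quotient_eq_zero_iff hL hqx hγ.2]
      have := (mem_orthogonal_projSpan_iff x).1 hxS γ hγ
      rwa [hproj] at this
    have hfin : (m : Measure ℝ).support.Finite := by
      refine (finite_polyGain_eq_zero (natDegree_quotient_le hL hx0 hqx).1).subset fun ν hν => ?_
      have h2 := support_subset_Icc hIcc hν
      refine ⟨h2, ?_⟩
      rcases le_total 0 ν with h3 | h3
      · exact (polyGain_eq_zero_iff _ _).2 (hz ν ⟨hν, h3, h2.2⟩)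
      · rw [← polyGain_neg]
        exact (polyGain_eq_zero_iff _ _).2
          (hz (-ν) ⟨neg_mem_support hneg hν, by linarith, by linarith [h2.1]⟩)
    have hΓfin : Γ.Finite := hfin.subset inter_subset_left
    refine ⟨hfin, ⟨fun j => f (φ j), fun j => hf _, mg, hmg, hlim⟩, ?_⟩
    rw [finsum_mem_eq_finite_toFinset_sum _ hΓfin]
    exact sum_kappa_add_kappaSum_lt hL hx0 hqx hΓfin.toFinset
      (by rw [Finite.coe_toFinset]; exact inter_subset_right)
      fun ω hω => hz ω ((Finite.mem_toFinset _).1 hω)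

end Maps

/-! ### Gaussian laws as linear images of the standard one. -/

section Gaussian

open scoped MatrixOrder

variable {n : ℕ}

theorem isSelfAdjoint_toEuclideanCLM_sqrt (S : Matrix (Fin n) (Fin n) ℝ) :
    IsSelfAdjoint (Matrix.toEuclideanCLM (𝕜 := ℝ) (CFC.sqrt S)) := by
  exact (CFC.sqrt_nonneg S).isSelfAdjoint.map _

theorem norm_toEuclideanCLM_sqrt_sq {S : Matrix (Fin n) (Fin n) ℝ} (hS : S.PosSemidef)
    (x : EuclideanSpace ℝ (Fin n)) :
    ‖Matrix.toEuclideanCLM (𝕜 := ℝ) (CFC.sqrt S) x‖ ^ 2 = x.ofLp ⬝ᵥ S.mulVec x.ofLp := by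
  rw [← real_inner_self_eq_norm_sq, ← ContinuousLinearMap.adjoint_inner_right,
    (isSelfAdjoint_toEuclideanCLM_sqrt S).adjoint_eq, ← ContinuousLinearMap.comp_apply,
    ← ContinuousLinearMap.mul_def, ← map_mul, CFC.sqrt_mul_sqrt_self _ hS.nonneg,
    Matrix.inner_toEuclideanCLM]

theorem multivariateGaussian_apply (μ : EuclideanSpace ℝ (Fin n)) (S : Matrix (Fin n) (Fin n) ℝ)
    {W : Set (EuclideanSpace ℝ (Fin n))} (hW : MeasurableSet W) :
    multivariateGaussian μ S W = stdGaussian (EuclideanSpace ℝ (Fin n))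
      {z | μ + Matrix.toEuclideanCLM (𝕜 := ℝ) (CFC.sqrt S) z ∈ W} := by
  rw [multivariateGaussian, Measure.map_apply (by fun_prop) hW]
  rfl

end Gaussian

/-! ### Consequences of invariance, and null sets of affine subspaces. -/

section Invariance

variable {n : ℕ} {M : AffineSubspace ℝ (EuclideanSpace ℝ (Fin n))}

theorem FunInvariant.apply_add {T : EuclideanSpace ℝ (Fin n) → ℝ}
    (hT : FunInvariant (affineGroup M) T) (hM : (M : Set (EuclideanSpace ℝ (Fin n))).Nonempty)
    {V L : Submodule ℝ (EuclideanSpace ℝ (Fin n))} (hV : FunInvariant (translations V) T)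
    (hL : L = Submodule.span ℝ ((M.direction : Set (EuclideanSpace ℝ (Fin n))) ∪ V))
    {l : EuclideanSpace ℝ (Fin n)} (hl : l ∈ L) (y : EuclideanSpace ℝ (Fin n)) :
    T (y + l) = T y := by
  rw [hL, Submodule.span_union, Submodule.span_eq, Submodule.span_eq, Submodule.mem_sup] at hl
  obtain ⟨d, hd, v, hv, rfl⟩ := hl
  rw [← add_assoc, hV _ ⟨v, hv, rfl⟩ (y + d)]
  obtain ⟨p, hp, p', hp', rfl⟩ := (AffineSubspace.mem_direction_iff_eq_vsub hM d).1 hd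
  rw [← hT _ ⟨1, one_ne_zero, p', hp', p, hp, rfl⟩ y, vsub_eq_sub]
  congr 1
  rw [one_smul]
  abel

/-- This removes the nuisance parameters: the group element with factor `t` moves `μ` to `μ₀` and
rescales `w`, and invariance under `L` discards the component of `w` in `L`. -/
theorem FunInvariant.apply_add_eq {T : EuclideanSpace ℝ (Fin n) → ℝ}
    (hT : FunInvariant (affineGroup M) T)
    {V L : Submodule ℝ (EuclideanSpace ℝ (Fin n))} (hV : FunInvariant (translations V) T)
    (hL : L = Submodule.span ℝ ((M.direction : Set (EuclideanSpace ℝ (Fin n))) ∪ V))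
    {μ μ₀ : EuclideanSpace ℝ (Fin n)} (hμ : μ ∈ M) (hμ₀ : μ₀ ∈ M) {t : ℝ} (ht : t ≠ 0)
    (w : EuclideanSpace ℝ (Fin n)) : T (μ + w) = T (μ₀ + t • Lᗮ.starProjection w) := by
  have h1 : t • Lᗮ.starProjection w - t • w ∈ L := by
    rw [← smul_sub]
    refine L.smul_mem _ ?_
    rw [← neg_sub, neg_mem_iff]
    simp
  rw [← hT _ ⟨t, ht, μ, hμ, μ₀, hμ₀, rfl⟩ (μ + w),
    ← hT.apply_add ⟨μ, hμ⟩ hV hL h1]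
  congr 1
  rw [add_sub_cancel_left]
  abel

theorem SetInvariant.add_mem_iff {N : Set (EuclideanSpace ℝ (Fin n))}
    (hN : SetInvariant (affineGroup M) N) {μ μ' : EuclideanSpace ℝ (Fin n)} (hμ : μ ∈ M)
    (hμ' : μ' ∈ M) (s : EuclideanSpace ℝ (Fin n)) : μ + s ∈ N ↔ μ' + s ∈ N := by
  have key : ∀ {μ μ' : EuclideanSpace ℝ (Fin n)}, μ ∈ M → μ' ∈ M → μ + s ∈ N → μ' + s ∈ N := by
    intro μ μ' hμ hμ' h
    rw [← hN _ ⟨1, one_ne_zero, μ, hμ, μ', hμ', rfl⟩]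
    refine ⟨μ + s, h, ?_⟩
    simp only [one_smul]
    abel
  exact ⟨key hμ hμ', key hμ' hμ⟩

theorem SetInvariant.affineLebesgue_eq {N : Set (EuclideanSpace ℝ (Fin n))}
    (hN : SetInvariant (affineGroup M) N) (hNm : MeasurableSet N)
    {μ μ' : EuclideanSpace ℝ (Fin n)} (hμ : μ ∈ M) (hμ' : μ' ∈ M)
    (S : Submodule ℝ (EuclideanSpace ℝ (Fin n))) :
    affineLebesgue μ S N = affineLebesgue μ' S N := by
  rw [affineLebesgue, affineLebesgue, Measure.map_apply (measurable_subtype_coe.const_add μ) hNm,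
    Measure.map_apply (measurable_subtype_coe.const_add μ') hNm]
  congr 1
  ext s
  exact hN.add_mem_iff hμ hμ' s

theorem SetInvariant.shift_subset_iff {N : Set (EuclideanSpace ℝ (Fin n))}
    (hN : SetInvariant (affineGroup M) N)
    {μ μ' : EuclideanSpace ℝ (Fin n)} (hμ : μ ∈ M) (hμ' : μ' ∈ M)
    (S : Submodule ℝ (EuclideanSpace ℝ (Fin n))) : shift μ S ⊆ N ↔ shift μ' S ⊆ N := by
  simp only [shift, image_subset_iff]
  exact forall₂_congr fun s _ => hN.add_mem_iff hμ hμ' s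

/-- Each affine piece meets `μ + S` either in everything or in a proper affine subspace, which is
null. When `S = {0}` the only proper one is empty. -/
theorem affineLebesgue_eq_zero_iff {N : Set (EuclideanSpace ℝ (Fin n))} (hNm : MeasurableSet N)
    (hN : IsCountableUnionOfAffine N) (μ : EuclideanSpace ℝ (Fin n))
    (S : Submodule ℝ (EuclideanSpace ℝ (Fin n))) :
    affineLebesgue μ S N = 0 ↔ ¬ shift μ S ⊆ N := by
  rw [affineLebesgue, Measure.map_apply (measurable_subtype_coe.const_add μ) hNm]
  set ν := (stdOrthonormalBasis ℝ S).toBasis.addHaar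
  constructor
  · intro h hsub
    have h1 : (fun s : S => μ + (s : EuclideanSpace ℝ (Fin n))) ⁻¹' N = univ :=
      eq_univ_of_forall fun s => hsub ⟨s, s.2, rfl⟩
    rw [h1] at h
    exact IsOpen.measure_ne_zero ν isOpen_univ univ_nonempty h
  · intro h
    obtain ⟨𝒜, h𝒜, rfl⟩ := hN
    rw [preimage_iUnion₂, measure_biUnion_null_iff h𝒜]
    intro A hA
    have h1 := Measure.addHaar_affineSubspace ν (A.comap
      ((AffineEquiv.constVAdd ℝ (EuclideanSpace ℝ (Fin n)) μ).toAffineMap.comp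
        S.subtype.toAffineMap))
    refine h1 fun htop => h ?_
    rintro _ ⟨s, hs, rfl⟩
    refine mem_biUnion hA ?_
    have h2 : (⟨s, hs⟩ : S) ∈ A.comap
      ((AffineEquiv.constVAdd ℝ (EuclideanSpace ℝ (Fin n)) μ).toAffineMap.comp
        S.subtype.toAffineMap) := htop ▸ AffineSubspace.mem_top _ _ _
    exact h2

end Invariance

/-! ### Size control and the main theorem. -/

theorem nullSpace_nonempty {n k q : ℕ} (X : Matrix (Fin n) (Fin k) ℝ)
    (R : Matrix (Fin q) (Fin k) ℝ) (hR : R.rank = q) (r : Fin q → ℝ) :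
    (nullSpace X R r : Set (EuclideanSpace ℝ (Fin n))).Nonempty := by
  have h : R.mulVecLin.range = ⊤ := by
    apply Submodule.eq_top_of_finrank_eq
    rw [Module.finrank_fin_fun]
    exact hR
  obtain ⟨β, hβ⟩ := LinearMap.range_eq_top.1 h r
  exact ⟨_, β, rfl, hβ⟩

open scoped MatrixOrder in
/-- Size control under the null-set condition. -/
theorem exists_size_le {n : ℕ} {M₀ : AffineSubspace ℝ (EuclideanSpace ℝ (Fin n))}
    (hM₀ : (M₀ : Set (EuclideanSpace ℝ (Fin n))).Nonempty)
    {𝔉 : Set (ℝ → ℝ)} (h𝔉 : 𝔉 ⊆ normalizedSpectralDensities)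
    {T : EuclideanSpace ℝ (Fin n) → ℝ} (hT : Measurable T)
    {N : Set (EuclideanSpace ℝ (Fin n))} (hN : IsClosed N) (hTN : ContinuousOn T Nᶜ)
    (hT_inv : FunInvariant (affineGroup M₀) T) (hN_inv : SetInvariant (affineGroup M₀) N)
    {V : Submodule ℝ (EuclideanSpace ℝ (Fin n))} (hT_V : FunInvariant (translations V) T)
    {L : Submodule ℝ (EuclideanSpace ℝ (Fin n))}
    (hL : L = Submodule.span ℝ ((M₀.direction : Set (EuclideanSpace ℝ (Fin n))) ∪ V))
    (hLn : Module.finrank ℝ L < n)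
    (hnull : ∀ S ∈ relevantSubspaces 𝔉 L, ∃ μ₀ ∈ M₀, affineLebesgue μ₀ S N = 0)
    {α : ℝ} (hα : 0 < α) : ∃ C : ℝ, size M₀ 𝔉 {y | C ≤ T y} ≤ ENNReal.ofReal α := by
  by_contra! hcon
  have hex : ∀ j : ℕ, ∃ μ ∈ M₀, ∃ σ : ℝ, 0 < σ ∧ ∃ f ∈ 𝔉, ENNReal.ofReal α <
      multivariateGaussian μ (σ ^ 2 • spectralMatrix n f) {y | (j : ℝ) ≤ T y} := by
    intro j
    have h := hcon j
    simp only [size, lt_iSup_iff] at h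
    obtain ⟨μ, hμ, σ, hσ, f, hf, h⟩ := h
    exact ⟨μ, hμ, σ, hσ, f, hf, h⟩
  choose μ hμ σ hσ f hf hlt using hex
  have hps : ∀ j, (σ j ^ 2 • spectralMatrix n (f j)).PosSemidef := fun j =>
    (posSemidef_spectralMatrix (h𝔉 (hf j))).smul (sq_nonneg _)
  set M := fun j => Matrix.toEuclideanCLM (𝕜 := ℝ) (CFC.sqrt (σ j ^ 2 • spectralMatrix n (f j)))
    with hM
  obtain ⟨φ, t, D, hφ, ht, hD, hrange⟩ := exists_limit_map hLn h𝔉 hf σ hσ M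
    (fun j => isSelfAdjoint_toEuclideanCLM_sqrt _) fun j x => by
      rw [hM, norm_toEuclideanCLM_sqrt_sq (hps j), Matrix.smul_mulVec, dotProduct_smul, smul_eq_mul]
  obtain ⟨μ₀, hμ₀⟩ := hM₀
  set Dj := fun j => t j • (Lᗮ.starProjection ∘L M (φ j)) with hDj
  -- Passing to the subsequence only lowers the threshold, from `φ j` to `j`, so the lower bound `α`
  -- survives.
  have hbound : ∀ j : ℕ, ENNReal.ofReal α ≤
      stdGaussian (EuclideanSpace ℝ (Fin n)) {z | (j : ℝ) ≤ T (μ₀ + Dj j z)} := by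
    intro j
    refine (hlt (φ j)).le.trans ?_
    rw [multivariateGaussian_apply _ _ (measurableSet_le measurable_const hT)]
    refine measure_mono fun z hz => ?_
    change ((φ j : ℕ) : ℝ) ≤ T (μ (φ j) + M (φ j) z) at hz
    rw [hT_inv.apply_add_eq hT_V hL (hμ (φ j)) hμ₀ (ht j)] at hz
    exact (Nat.cast_le.2 (hφ.id_le j)).trans hz
  have hlim : Tendsto (fun j : ℕ => stdGaussian (EuclideanSpace ℝ (Fin n))
      {z | (j : ℝ) ≤ T (μ₀ + Dj j z)}) atTop (𝓝 0) := by
    rcases hrange with hr | hr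
    -- Full range: the sets `W j` decrease to the empty set because `T` takes finite values, and
    -- every `Dj j` maps into `Lᗮ`, the range of `D`.
    · refine tendsto_stdGaussian_preimage_of_range_le (W := fun j => {y | (j : ℝ) ≤ T (μ₀ + y)})
        (fun a b hab y (hy : (b : ℝ) ≤ T (μ₀ + y)) => le_trans (Nat.cast_le.2 hab) hy)
        (fun j => measurableSet_le measurable_const (hT.comp (measurable_const_add μ₀))) ?_ hD ?_
      · refine eq_empty_of_forall_notMem fun y hy => ?_
        obtain ⟨j, hj⟩ := exists_nat_gt (T (μ₀ + y))
        exact (mem_iInter.1 hy j).not_gt hj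
      · intro j z
        have h1 : Dj j z ∈ Lᗮ := Lᗮ.smul_mem _ (Submodule.starProjection_apply_mem _ _)
        rw [← hr] at h1
        exact h1
    · obtain ⟨μ₁, hμ₁, h1⟩ := hnull _ hr
      rw [hN_inv.affineLebesgue_eq hN.measurableSet hμ₁ hμ₀] at h1
      exact tendsto_stdGaussian_of_ae_notMem hT hN hTN hD μ₀
        (ae_notMem_of_affineLebesgue_eq_zero hN D rfl h1)
  have h0 := ge_of_tendsto' hlim hbound
  exact (ENNReal.ofReal_pos.2 hα).not_ge h0

end SizeControl

end

theorem mainTheorem5 {n k q : ℕ} (hk : 1 ≤ k) (hkn : k < n) (hq : 1 ≤ q)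
    (X : Matrix (Fin n) (Fin k) ℝ) (hX : X.rank = k)
    (R : Matrix (Fin q) (Fin k) ℝ) (hR : R.rank = q) (r : Fin q → ℝ)
    (M₀ : AffineSubspace ℝ (EuclideanSpace ℝ (Fin n))) (hM₀ : M₀ = SizeControl.nullSpace X R r)
    (𝔉 : Set (ℝ → ℝ)) (h𝔉 : 𝔉.Nonempty) (h𝔉_all : 𝔉 ⊆ SizeControl.normalizedSpectralDensities)
    (T : EuclideanSpace ℝ (Fin n) → ℝ) (hT : Measurable T)
    (N : Set (EuclideanSpace ℝ (Fin n))) (hN : IsClosed N) (hTN : ContinuousOn T Nᶜ)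
    (hT_inv : SizeControl.FunInvariant (SizeControl.affineGroup M₀) T)
    (hN_inv : SizeControl.SetInvariant (SizeControl.affineGroup M₀) N)
    (V : Submodule ℝ (EuclideanSpace ℝ (Fin n)))
    (hT_V : SizeControl.FunInvariant (SizeControl.translations V) T)
    (hN_V : SizeControl.SetInvariant (SizeControl.translations V) N)
    (L : Submodule ℝ (EuclideanSpace ℝ (Fin n)))
    (hL : L = Submodule.span ℝ ((M₀.direction : Set (EuclideanSpace ℝ (Fin n))) ∪ V))
    (hLn : Module.finrank ℝ L < n) :
    -- Part 1: size control under the null-set condition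
    ((∀ S ∈ SizeControl.relevantSubspaces 𝔉 L,
        ∃ μ₀ ∈ M₀, SizeControl.affineLebesgue μ₀ S N = 0) →
      ∀ α : ℝ, 0 < α → α < 1 →
        ∃ C : ℝ, SizeControl.size M₀ 𝔉 {y | C ≤ T y} ≤ ENNReal.ofReal α) ∧
    -- "for some" and "for all" null means are the same in that condition
    (∀ S ∈ SizeControl.relevantSubspaces 𝔉 L,
      (∃ μ₀ ∈ M₀, SizeControl.affineLebesgue μ₀ S N = 0) ↔
        ∀ μ₀ ∈ M₀, SizeControl.affineLebesgue μ₀ S N = 0) ∧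
    (SizeControl.IsCountableUnionOfAffine N →
      -- the null-set condition may be replaced by non-inclusion
      (∀ S ∈ SizeControl.relevantSubspaces 𝔉 L,
        ((∃ μ₀ ∈ M₀, SizeControl.affineLebesgue μ₀ S N = 0) ↔
          ∃ μ₀ ∈ M₀, ¬ SizeControl.shift μ₀ S ⊆ N) ∧
        ((∃ μ₀ ∈ M₀, ¬ SizeControl.shift μ₀ S ⊆ N) ↔
          ∀ μ₀ ∈ M₀, ¬ SizeControl.shift μ₀ S ⊆ N)) ∧
      -- Part 2: the single-frequency sufficient condition
      ((∀ γ ∈ ⋃₀ SizeControl.limitSupports 𝔉 L,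
          ∃ μ₀ ∈ M₀, ¬ SizeControl.shift μ₀ (SizeControl.projSpan L {γ}) ⊆ N) →
        ∀ S ∈ SizeControl.relevantSubspaces 𝔉 L,
          ∃ μ₀ ∈ M₀, SizeControl.affineLebesgue μ₀ S N = 0) ∧
      -- "for some" and "for all" null means are the same in that condition
      (∀ γ ∈ Icc (0 : ℝ) Real.pi,
        (∃ μ₀ ∈ M₀, ¬ SizeControl.shift μ₀ (SizeControl.projSpan L {γ}) ⊆ N) ↔
          ∀ μ₀ ∈ M₀, ¬ SizeControl.shift μ₀ (SizeControl.projSpan L {γ}) ⊆ N) ∧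
      -- the stricter condition, with the frequency ranging over all of `[0, π]`
      ((∀ γ ∈ Icc (0 : ℝ) Real.pi,
          ∃ μ₀ ∈ M₀, ¬ SizeControl.shift μ₀ (SizeControl.projSpan L {γ}) ⊆ N) →
        (∀ γ ∈ ⋃₀ SizeControl.limitSupports 𝔉 L,
          ∃ μ₀ ∈ M₀, ¬ SizeControl.shift μ₀ (SizeControl.projSpan L {γ}) ⊆ N) ∧
        ∀ S ∈ SizeControl.relevantSubspaces 𝔉 L,
          ∃ μ₀ ∈ M₀, SizeControl.affineLebesgue μ₀ S N = 0)) := by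
  have hM₀ne : (M₀ : Set (EuclideanSpace ℝ (Fin n))).Nonempty := by
    rw [hM₀]
    exact SizeControl.nullSpace_nonempty X R hR r
  have hleb : ∀ S, (∃ μ₀ ∈ M₀, SizeControl.affineLebesgue μ₀ S N = 0) ↔
      ∀ μ₀ ∈ M₀, SizeControl.affineLebesgue μ₀ S N = 0 := fun S =>
    ⟨fun ⟨μ, hμ, h⟩ μ' hμ' =>
      (hN_inv.affineLebesgue_eq hN.measurableSet hμ' hμ S).trans h,
      fun h => ⟨hM₀ne.some, hM₀ne.some_mem, h _ hM₀ne.some_mem⟩⟩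
  have hshift : ∀ S, (∃ μ₀ ∈ M₀, ¬ SizeControl.shift μ₀ S ⊆ N) ↔
      ∀ μ₀ ∈ M₀, ¬ SizeControl.shift μ₀ S ⊆ N := fun S =>
    ⟨fun ⟨μ, hμ, h⟩ μ' hμ' h' => h ((hN_inv.shift_subset_iff hμ' hμ S).1 h'),
      fun h => ⟨hM₀ne.some, hM₀ne.some_mem, h _ hM₀ne.some_mem⟩⟩
  refine ⟨fun h α hα _ => SizeControl.exists_size_le hM₀ne h𝔉_all hT hN hTN hT_inv hN_inv hT_V hL
    hLn h hα, fun S _ => hleb S, fun hU => ?_⟩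
  have hiff : ∀ S, (∃ μ₀ ∈ M₀, SizeControl.affineLebesgue μ₀ S N = 0) ↔
      ∃ μ₀ ∈ M₀, ¬ SizeControl.shift μ₀ S ⊆ N := fun S =>
    exists_congr fun μ₀ => and_congr_right fun _ =>
      SizeControl.affineLebesgue_eq_zero_iff hN.measurableSet hU μ₀ S
  have hsingle : (∀ γ ∈ ⋃₀ SizeControl.limitSupports 𝔉 L,
      ∃ μ₀ ∈ M₀, ¬ SizeControl.shift μ₀ (SizeControl.projSpan L {γ}) ⊆ N) →
      ∀ S ∈ SizeControl.relevantSubspaces 𝔉 L,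
        ∃ μ₀ ∈ M₀, SizeControl.affineLebesgue μ₀ S N = 0 := by
    rintro h _ ⟨-, Γ, hΓ, rfl⟩
    -- One frequency of `Γ` suffices: if `N` contained the shift of `projSpan L Γ`, it would contain
    -- the shift of the smaller space `projSpan L {γ}`. Such a frequency exists because limit
    -- measures have mass one.
    obtain ⟨γ, hγ⟩ := SizeControl.limitSupports_nonempty hLn h𝔉_all hΓ
    obtain ⟨μ₀, hμ₀, h1⟩ := h γ ⟨Γ, hΓ, hγ⟩
    refine (hiff _).2 ⟨μ₀, hμ₀, fun h2 => h1 (Subset.trans (image_mono ?_) h2)⟩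
    exact SizeControl.projSpan_mono (singleton_subset_iff.2 hγ)
  have hall : (∀ γ ∈ Icc (0 : ℝ) Real.pi,
      ∃ μ₀ ∈ M₀, ¬ SizeControl.shift μ₀ (SizeControl.projSpan L {γ}) ⊆ N) →
      ∀ γ ∈ ⋃₀ SizeControl.limitSupports 𝔉 L,
        ∃ μ₀ ∈ M₀, ¬ SizeControl.shift μ₀ (SizeControl.projSpan L {γ}) ⊆ N := by
    rintro h γ ⟨_, ⟨m, -, rfl⟩, hγ⟩
    exact h γ hγ.2
  exact ⟨fun S _ => ⟨hiff S, hshift S⟩, hsingle, fun γ _ => hshift _,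
    fun h => ⟨hall h, hsingle (hall h)⟩⟩
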